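/- **Theorem (universal property of the Gray product).** *Conventions.* A scaled simplicial set is a pair $X=(\overline X,T_X)$ of a simplicial set $\overline X$ and a set $T_X$ of $2$-simplices (the *thin* triangles) containing the degenerate ones; maps preserve thin triangles. An $\infty$-bicategory is a scaled simplicial set with the extension property with respect to the generating anodyne maps: (a) $(\Lambda^n_i,\Delta^{\{i-1,i,i+1\}})\to(\Delta^n,\Delta^{\{i-1,i,i+1\}})$ for $n\ge 2$, $0<i<n$; (b) $(\Delta^4,T)\to(\Delta^4,T\cup\{\Delta^{\{0,3,4\}},\Delta^{\{0,1,4\}}\})$ with $T=\{\Delta^{\{0,2,4\}},\Delta^{\{1,2,3\}},\Delta^{\{0,1,3\}},\Delta^{\{1,3,4\}},\Delta^{\{0,1,2\}}\}$; (c) $(\Lambda^n_0\amalg_{\Delta^{\{0,1\}}}\Delta^0,\Delta^{\{0,1,n\}})\to(\Delta^n\amalg_{\Delta^{\{0,1\}}}\Delta^0,\Delta^{\{0,1,n\}})$ for $n\ge 3$. An edge of $X$ is *invertible* if it becomes an isomorphism in the homotopy category of the core $X^{\mathrm{th}}$, the simplicial subset of the simplices all of whose $2$-dimensional faces are thin.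 $\mathrm{Fun}(X,Y)$ is the internal mapping object of scaled simplicial sets for the cartesian product; its vertices are the maps $X\to Y$. A functor of $\infty$-bicategories is *fully faithful* if it induces equivalences on the mapping $\infty$-categories $\mathrm{Hom}(x,y)$, and its *essential image* consists of the objects that are the target of an invertible edge whose source is in the image. For $\infty$-bicategories $\mathcal C,\mathcal D$: * The Gray product $\mathcal C\otimes\mathcal D$ is $\overline{\mathcal C}\times\overline{\mathcal D}$ with thin triangles those $(\alpha,\beta)\in T_{\mathcal C}\times T_{\mathcal D}$ such that $\alpha$ degenerates along $\Delta^{\{1,2\}}$ or $\beta$ degenerates along $\Delta^{\{0,1\}}$ (that is, both the triangle and the named edge are degenerate). * $T_{\simeq}\subseteq T_{\mathcal C}\times T_{\mathcal D}$ is the set of those $(\alpha,\beta)$ such that $\alpha|_{\Delta^{\{1,2\}}}$ or $\beta|_{\Delta^{\{0,1\}}}$ is invertible. * $L_{\mathcal C}\subseteq T_{\mathcal C}$ is the set of thin triangles $\sigma$ such that $\sigma|_{\Delta^{\{0,1\}}}$ or $\sigma|_{\Delta^{\{1,2\}}}$ is invertible. An *oplax functor* $\mathcal C\rightsquigarrow\mathcal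 E$ is a map of scaled simplicial sets $(\overline{\mathcal C},L_{\mathcal C})\to\mathcal E$, and $\mathrm{Fun}_{\mathrm{oplax}}(\mathcal C,\mathcal E):=\mathrm{Fun}((\overline{\mathcal C},L_{\mathcal C}),\mathcal E)$. *Statement.* Let $\mathcal C,\mathcal D,\mathcal E$ be $\infty$-bicategories. The restriction map $$\mathrm{Fun}((\overline{\mathcal C}\times\overline{\mathcal D},T_{\simeq}),\mathcal E)\to\mathrm{Fun}(\mathcal C\otimes\mathcal D,\mathcal E)$$ is an isomorphism of scaled simplicial sets, and, since $L_{\mathcal C\times\mathcal D}\subseteq T_{\simeq}$, there is a restriction functor $$\mathrm{Fun}(\mathcal C\otimes\mathcal D,\mathcal E)\cong\mathrm{Fun}((\overline{\mathcal C}\times\overline{\mathcal D},T_{\simeq}),\mathcal E)\to\mathrm{Fun}_{\mathrm{oplax}}(\mathcal C\times\mathcal D,\mathcal E).$$ This functor is fully faithful, and its essential image consists of exactly those oplax functors $\varphi\colon\mathcal C\times\mathcal D\rightsquigarrow\mathcal E$ such that (i) for all objects $x\in\mathcal C$ and $y\in\mathcal D$, the restrictions of $\varphi$ to $\{x\}\times\mathcal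 D$ and to $\mathcal C\times\{y\}$ are maps of scaled simplicial sets (they send all the thin triangles of $\mathcal D$, respectively of $\mathcal C$, to thin triangles of $\mathcal E$); and (ii) for all edges $f\colon x\to x'$ of $\mathcal C$ and $g\colon y\to y'$ of $\mathcal D$, the triangle of $\mathcal C\times\mathcal D$ with successive edges $(f,\mathrm{id}_y)\colon(x,y)\to(x',y)$ and $(\mathrm{id}_{x'},g)\colon(x',y)\to(x',y')$ and with third edge $(f,g)$, i.e. $(s_1f,s_0g)$, is sent by $\varphi$ to a thin triangle of $\mathcal E$. -/

import Mathlib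

universe u

open CategoryTheory Opposite Simplicial MonoidalCategory CartesianMonoidalCategory

/-! ## Scaled simplicial sets -/

/-- A scaled simplicial set: a simplicial set with a set of thin `2`-simplices which
contains all the degenerate ones. -/
structure ScaledSSet : Type (u + 1) where
  /-- the underlying simplicial set -/
  toSSet : SSet.{u}
  /-- the thin triangles -/
  thin : Set (toSSet _⦋2⦌)
  degenerate_subset : toSSet.degenerate 2 ⊆ thin

namespace ScaledSSet

/-- A map of the underlying simplicial sets is a map of scaled simplicial sets
if it sends thin triangles to thin triangles. -/
def IsScaledMap (X Y : ScaledSSet.{u}) (f : X.toSSet ⟶ Y.toSSet) : Prop :=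
  ∀ σ ∈ X.thin, f.app (op ⦋2⦌) σ ∈ Y.thin

/-- Maps of scaled simplicial sets. -/
@[ext]
structure Hom (X Y : ScaledSSet.{u}) where
  /-- the underlying map of simplicial sets -/
  hom : X.toSSet ⟶ Y.toSSet
  isScaledMap : IsScaledMap X Y hom

instance : Category.{u} ScaledSSet.{u} where
  Hom := Hom
  id X := ⟨𝟙 X.toSSet, fun _ h => h⟩
  comp f g := ⟨f.hom ≫ g.hom, fun σ h => g.isScaledMap _ (f.isScaledMap σ h)⟩

@[ext]
theorem hom_ext {X Y : ScaledSSet.{u}} {f g : X ⟶ Y} (h : f.hom = g.hom) : f = g :=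
  Hom.ext h

@[simp]
theorem id_hom (X : ScaledSSet.{u}) : Hom.hom (𝟙 X) = 𝟙 X.toSSet := rfl

@[simp]
theorem comp_hom {X Y Z : ScaledSSet.{u}} (f : X ⟶ Y) (g : Y ⟶ Z) :
    (f ≫ g).hom = f.hom ≫ g.hom := rfl

/-- `(X, T)`: the scaled simplicial set whose thin triangles are those in `T` together with
the degenerate ones. -/
def withThin (X : SSet.{u}) (T : Set (X _⦋2⦌)) : ScaledSSet.{u} where
  toSSet := X
  thin := X.degenerate 2 ∪ T
  degenerate_subset := Set.subset_union_left

/-- The minimal scaling `X_♭`: only the degenerate triangles are thin. -/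
def flat (X : SSet.{u}) : ScaledSSet.{u} where
  toSSet := X
  thin := X.degenerate 2
  degenerate_subset := subset_rfl

/-- The maximal scaling `X_♯`: all the triangles are thin. -/
def sharp (X : SSet.{u}) : ScaledSSet.{u} where
  toSSet := X
  thin := Set.univ
  degenerate_subset := Set.subset_univ _

/-- Functoriality of the minimal scaling. -/
def flatMap {X Y : SSet.{u}} (f : X ⟶ Y) : flat X ⟶ flat Y :=
  Hom.mk f (fun _ h => SSet.degenerate_app_apply h f)

/-- The restriction `(A, T|_A)` of the scaling of `X` to a simplicial subset `A`. -/
def restrict (X : ScaledSSet.{u}) (A : X.toSSet.Subcomplex) : ScaledSSet.{u} where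
  toSSet := A
  thin := {σ | A.ι.app (op ⦋2⦌) σ ∈ X.thin}
  degenerate_subset := fun _ h => X.degenerate_subset (SSet.degenerate_app_apply h A.ι)

/-- The inclusion of `(A, T|_A)` in `(X, T)`. -/
def restrictι (X : ScaledSSet.{u}) (A : X.toSSet.Subcomplex) : restrict X A ⟶ X :=
  Hom.mk A.ι (fun _ h => h)

/-- The pushout `A ⨿_{Δ¹} Δ⁰`, which collapses the edge `e` of `A` to a point. The underlying
simplicial set is the pushout in simplicial sets, and the thin triangles are the images of
those of `A` (together with the degenerate ones). -/
noncomputable def collapse (A : ScaledSSet.{u}) (e : A.toSSet _⦋1⦌) : ScaledSSet.{u} :=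
  withThin
    (Limits.pushout (SSet.yonedaEquiv.symm e)
      (SSet.const (SSet.stdSimplex.obj₀Equiv.symm 0) : Δ[1] ⟶ (Δ[0] : SSet.{u})))
    ((Limits.pushout.inl (SSet.yonedaEquiv.symm e)
      (SSet.const (SSet.stdSimplex.obj₀Equiv.symm 0) : Δ[1] ⟶ (Δ[0] : SSet.{u}))).app (op ⦋2⦌) ''
        A.thin)

/-- The map `A ⨿_{Δ¹} Δ⁰ ⟶ B ⨿_{Δ¹} Δ⁰` induced by `f : A ⟶ B`. -/
noncomputable def collapseMap {A B : ScaledSSet.{u}} (f : A ⟶ B) (e : A.toSSet _⦋1⦌) :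
    collapse A e ⟶ collapse B (f.hom.app (op ⦋1⦌) e) :=
  Hom.mk
    (Limits.pushout.map _ _ _ _ f.hom (𝟙 _) (𝟙 _)
      (by rw [Category.id_comp, SSet.yonedaEquiv_symm_comp]) (by simp))
    (by
      rintro σ (hσ | ⟨τ, hτ, rfl⟩)
      · exact Or.inl (SSet.degenerate_app_apply hσ _)
      · refine Or.inr ⟨f.hom.app _ τ, f.isScaledMap τ hτ, ?_⟩
        have h := Limits.pushout.inl_desc (f := SSet.yonedaEquiv.symm e)
          (g := (SSet.const (SSet.stdSimplex.obj₀Equiv.symm 0) : Δ[1] ⟶ (Δ[0] : SSet.{u})))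
          (f.hom ≫ Limits.pushout.inl (SSet.yonedaEquiv.symm (f.hom.app (op ⦋1⦌) e))
            (SSet.const (SSet.stdSimplex.obj₀Equiv.symm 0) : Δ[1] ⟶ (Δ[0] : SSet.{u})))
          (𝟙 _ ≫ Limits.pushout.inr _ _)
          (by
            rw [← Category.assoc, SSet.yonedaEquiv_symm_comp, Limits.pushout.condition]
            simp)
        exact (ConcreteCategory.congr_hom (congr_app h (op ⦋2⦌)) τ).symm)

/-! ## ∞-bicategories -/

/-- The face `Δ^{a,b,c}` of `Δⁿ`, as a `2`-simplex. -/
abbrev tri {n : ℕ} (a b c : Fin (n + 1)) (hab : a ≤ b := by decide) (hbc : b ≤ c := by decide) :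
    (Δ[n] : SSet.{u}) _⦋2⦌ :=
  SSet.stdSimplex.triangle a b c hab hbc

/-- `(Δⁿ⁺², Δ^{k-1,k,k+1})` for the inner vertex `k = i + 1` of `Δⁿ⁺²`. -/
def innerSimplex (n : ℕ) (i : Fin (n + 1)) : ScaledSSet.{u} :=
  withThin Δ[n + 2] {tri i.castSucc.castSucc i.succ.castSucc i.succ.succ
    (by simp [Fin.le_def]) (by simp [Fin.le_def])}

/-- `(Δⁿ⁺³, Δ^{0,1,n+3})`. -/
def outerSimplex (n : ℕ) : ScaledSSet.{u} :=
  withThin Δ[n + 3] {tri 0 1 (Fin.last (n + 3)) (by simp) (Fin.le_last _)}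

/-- The scaling `T` of `Δ⁴` in the saturation axiom. -/
def saturationSource : Set ((Δ[4] : SSet.{u}) _⦋2⦌) :=
  {tri 0 2 4, tri 1 2 3, tri 0 1 3, tri 1 3 4, tri 0 1 2}

/-- The scaling `T ∪ {Δ^{0,3,4}, Δ^{0,1,4}}` of `Δ⁴` in the saturation axiom. -/
def saturationTarget : Set ((Δ[4] : SSet.{u}) _⦋2⦌) :=
  saturationSource ∪ {tri 0 3 4, tri 0 1 4}

/-- The generating anodyne morphisms of scaled simplicial sets. -/
inductive GeneratingAnodyne : ∀ {K L : ScaledSSet.{u}}, (K ⟶ L) → Prop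
  /-- `(Λᵐ_k, Δ^{k-1,k,k+1}) ⟶ (Δᵐ, Δ^{k-1,k,k+1})`, for `0 < k < m`;
  here `m = n + 2` and `k = i + 1`. -/
  | inner (n : ℕ) (i : Fin (n + 1)) :
      GeneratingAnodyne
        (restrictι (innerSimplex.{u} n i) (SSet.horn (n + 2) i.succ.castSucc))
  /-- `(Δ⁴, T) ⟶ (Δ⁴, T ∪ {Δ^{0,3,4}, Δ^{0,1,4}})`. -/
  | saturation :
      GeneratingAnodyne
        (Hom.mk (X := withThin.{u} Δ[4] saturationSource)
          (Y := withThin.{u} Δ[4] saturationTarget) (𝟙 _)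
          (fun _ h => h.imp id Or.inl))
  /-- `(Λᵐ_0 ⨿_{Δ^{0,1}} Δ⁰, Δ^{0,1,m}) ⟶ (Δᵐ ⨿_{Δ^{0,1}} Δ⁰, Δ^{0,1,m})`, for `m ≥ 3`;
  here `m = n + 3`. -/
  | outer (n : ℕ) :
      GeneratingAnodyne
        (collapseMap (restrictι (outerSimplex.{u} n) (SSet.horn (n + 3) 0))
          (SSet.horn.edge₃ (n + 3) 0 0 1 (by simp) (by omega)))

/-- An ∞-bicategory is a scaled simplicial set with the extension property with respect to
the generating anodyne morphisms. -/
def IsInfBicategory (X : ScaledSSet.{u}) : Prop :=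
  ∀ ⦃K L : ScaledSSet.{u}⦄ (i : K ⟶ L), GeneratingAnodyne i →
    ∀ f : K ⟶ X, ∃ g : L ⟶ X, i ≫ g = f

/-! ## The core and invertible edges -/

/-- The core `X^th`: the simplices all of whose `2`-dimensional faces are thin. -/
def core (X : ScaledSSet.{u}) : X.toSSet.Subcomplex where
  obj n := {x | ∀ g : ⦋2⦌ ⟶ n.unop, X.toSSet.map g.op x ∈ X.thin}
  map {_ _} f x hx g := by
    have := hx (g ≫ f.unop)
    rwa [op_comp, Functor.map_comp_apply] at this

theorem edge_mem_core (X : ScaledSSet.{u}) (e : X.toSSet _⦋1⦌) : e ∈ X.core.obj (op ⦋1⦌) :=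
  fun g => X.degenerate_subset ⟨1, by norm_num, g, e, rfl⟩

/-- The map induced on cores by a map of scaled simplicial sets. -/
def coreMap {X Y : ScaledSSet.{u}} (f : X ⟶ Y) : (X.core : SSet.{u}) ⟶ (Y.core : SSet.{u}) :=
  SSet.Subcomplex.lift (X.core.ι ≫ f.hom) (by
    rintro n _ ⟨x, rfl⟩ g
    have := f.isScaledMap _ (x.2 g)
    rwa [NatTrans.naturality_apply] at this)

/-- An edge `e` of `X` is invertible if its image in the homotopy category of the core `X^th`
is an isomorphism. -/
def IsInvertible (X : ScaledSSet.{u}) (e : X.toSSet _⦋1⦌) : Prop :=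
  IsIso (SSet.Truncated.HomotopyCategory.homMk
    (SSet.Edge.mk' (X := (X.core : SSet.{u})) ⟨e, X.edge_mem_core e⟩).toTruncated)

theorem isIso_homMk_map {V W : SSet.Truncated.{u} 2} (f : V ⟶ W)
    {x y : V.obj (op ⟨⦋0⦌, by simp⟩)} (e : SSet.Truncated.Edge x y)
    (he : IsIso (SSet.Truncated.HomotopyCategory.homMk e)) :
    IsIso (SSet.Truncated.HomotopyCategory.homMk (e.map f)) := by
  rw [← SSet.Truncated.mapHomotopyCategory_homMk]
  exact Functor.map_isIso _ _

theorem isIso_homMk_congr {V : SSet.Truncated.{u} 2}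
    {x y x' y' : V.obj (op ⟨⦋0⦌, by simp⟩)} (e : SSet.Truncated.Edge x y)
    (e' : SSet.Truncated.Edge x' y') (h : e.edge = e'.edge)
    (he : IsIso (SSet.Truncated.HomotopyCategory.homMk e)) :
    IsIso (SSet.Truncated.HomotopyCategory.homMk e') :=
  ((MorphismProperty.isomorphisms _).arrow_mk_iso_iff
    (eqToIso (SSet.Truncated.HomotopyCategory.congr_arrowMk_homMk e e' h))).1 he

theorem isIso_homMk_id {V : SSet.Truncated.{u} 2} (x : V.obj (op ⟨⦋0⦌, by simp⟩)) :
    IsIso (SSet.Truncated.HomotopyCategory.homMk (SSet.Truncated.Edge.id x)) := by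
  rw [SSet.Truncated.HomotopyCategory.homMk_id]
  infer_instance

/-- Maps of scaled simplicial sets preserve invertible edges. -/
theorem IsInvertible.map {X Y : ScaledSSet.{u}} (f : X ⟶ Y) {e : X.toSSet _⦋1⦌}
    (he : X.IsInvertible e) : Y.IsInvertible (f.hom.app (op ⦋1⦌) e) :=
  isIso_homMk_congr
    ((SSet.Edge.mk' (X := (X.core : SSet.{u})) ⟨e, X.edge_mem_core e⟩).toTruncated.map
      ((SSet.truncation 2).map (coreMap f))) _ rfl
    (isIso_homMk_map ((SSet.truncation 2).map (coreMap f)) _ he)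

/-- Degenerate edges are invertible. -/
theorem isInvertible_of_degenerate (X : ScaledSSet.{u}) {e : X.toSSet _⦋1⦌}
    (he : e ∈ X.toSSet.degenerate 1) : X.IsInvertible e := by
  rw [SSet.degenerate_eq_iUnion_range_σ] at he
  simp only [Set.mem_iUnion, Set.mem_range] at he
  obtain ⟨i, x, rfl⟩ := he
  have hx : x ∈ X.core.obj (op ⦋0⦌) :=
    fun g => X.degenerate_subset ⟨0, by norm_num, g, x, rfl⟩
  fin_cases i
  exact isIso_homMk_congr (SSet.Edge.id (X := (X.core : SSet.{u})) ⟨x, hx⟩).toTruncated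
    (SSet.Edge.mk' (X := (X.core : SSet.{u}))
      ⟨X.toSSet.σ 0 x, X.edge_mem_core _⟩).toTruncated rfl
    (isIso_homMk_id (V := (SSet.truncation 2).obj (X.core : SSet.{u})) _)

theorem degenerate_triangle {X : SSet.{u}} {σ : X _⦋2⦌} (h : σ ∈ X.degenerate 2) :
    (∃ e : X _⦋1⦌, σ = X.σ 0 e) ∨ ∃ e : X _⦋1⦌, σ = X.σ 1 e := by
  rw [SSet.degenerate_eq_iUnion_range_σ] at h
  simp only [Set.mem_iUnion, Set.mem_range] at h
  obtain ⟨i, e, rfl⟩ := h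
  fin_cases i
  · exact Or.inl ⟨e, rfl⟩
  · exact Or.inr ⟨e, rfl⟩

theorem δ_two_σ_zero {X : SSet.{u}} (e : X _⦋1⦌) :
    X.δ 2 (X.σ 0 e) ∈ X.degenerate 1 := by
  have h : X.δ 2 (X.σ 0 e) = X.σ 0 (X.δ 1 e) :=
    ConcreteCategory.congr_hom
      (SimplicialObject.δ_comp_σ_of_gt X (i := (1 : Fin 2)) (j := (0 : Fin 1)) (by decide)) e
  rw [h]
  exact SSet.σ_mem_degenerate _ _ _

theorem δ_zero_σ_one {X : SSet.{u}} (e : X _⦋1⦌) :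
    X.δ 0 (X.σ 1 e) ∈ X.degenerate 1 := by
  have h : X.δ 0 (X.σ 1 e) = X.σ 0 (X.δ 0 e) :=
    ConcreteCategory.congr_hom
      (SimplicialObject.δ_comp_σ_of_le X (i := (0 : Fin 2)) (j := (0 : Fin 1)) (by decide)) e
  rw [h]
  exact SSet.σ_mem_degenerate _ _ _

/-! ## The cartesian product, the Gray product and the oplax scaling -/

/-- The cartesian product of scaled simplicial sets. -/
def prod (X Y : ScaledSSet.{u}) : ScaledSSet.{u} where
  toSSet := X.toSSet ⊗ Y.toSSet
  thin := {σ | σ.1 ∈ X.thin ∧ σ.2 ∈ Y.thin}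
  degenerate_subset := fun _ h =>
    ⟨X.degenerate_subset (SSet.degenerate_app_apply h (fst X.toSSet Y.toSSet)),
      Y.degenerate_subset (SSet.degenerate_app_apply h (snd X.toSSet Y.toSSet))⟩

/-- The first projection. -/
def prodFst (X Y : ScaledSSet.{u}) : prod X Y ⟶ X :=
  Hom.mk (fst X.toSSet Y.toSSet) (fun _ h => h.1)

/-- The second projection. -/
def prodSnd (X Y : ScaledSSet.{u}) : prod X Y ⟶ Y :=
  Hom.mk (snd X.toSSet Y.toSSet) (fun _ h => h.2)

/-- Functoriality of the cartesian product. -/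
def prodMap {X X' Y Y' : ScaledSSet.{u}} (f : X ⟶ X') (g : Y ⟶ Y') : prod X Y ⟶ prod X' Y' :=
  Hom.mk (f.hom ⊗ₘ g.hom) (fun σ h => ⟨f.isScaledMap σ.1 h.1, g.isScaledMap σ.2 h.2⟩)

/-- The triangle `σ` degenerates along `Δ^{0,1}`: both `σ` and its edge `Δ^{0,1}` are
degenerate. -/
def DegeneratesAlong01 {X : SSet.{u}} (σ : X _⦋2⦌) : Prop :=
  σ ∈ X.degenerate 2 ∧ X.δ 2 σ ∈ X.degenerate 1

/-- The triangle `σ` degenerates along `Δ^{1,2}`: both `σ` and its edge `Δ^{1,2}` are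
degenerate. -/
def DegeneratesAlong12 {X : SSet.{u}} (σ : X _⦋2⦌) : Prop :=
  σ ∈ X.degenerate 2 ∧ X.δ 0 σ ∈ X.degenerate 1

/-- The Gray product `X ⊗ Y`. -/
def gray (X Y : ScaledSSet.{u}) : ScaledSSet.{u} where
  toSSet := X.toSSet ⊗ Y.toSSet
  thin := {σ | (σ.1 ∈ X.thin ∧ σ.2 ∈ Y.thin) ∧
    (DegeneratesAlong12 σ.1 ∨ DegeneratesAlong01 σ.2)}
  degenerate_subset := fun σ h => by
    refine ⟨(prod X Y).degenerate_subset h, ?_⟩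
    rcases degenerate_triangle h with ⟨e, rfl⟩ | ⟨e, rfl⟩
    · exact Or.inr ⟨SSet.σ_mem_degenerate _ 0 e.2, δ_two_σ_zero e.2⟩
    · exact Or.inl ⟨SSet.σ_mem_degenerate _ 1 e.1, δ_zero_σ_one e.1⟩

/-- The product of the underlying simplicial sets with the scaling `T_≃`: the pairs of thin
triangles `(α, β)` such that `α|Δ^{1,2}` is invertible in `X` or `β|Δ^{0,1}` is invertible
in `Y`. -/
def grayInv (X Y : ScaledSSet.{u}) : ScaledSSet.{u} where
  toSSet := X.toSSet ⊗ Y.toSSet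
  thin := {σ | (σ.1 ∈ X.thin ∧ σ.2 ∈ Y.thin) ∧
    (X.IsInvertible (X.toSSet.δ 0 σ.1) ∨ Y.IsInvertible (Y.toSSet.δ 2 σ.2))}
  degenerate_subset := fun _ h =>
    ⟨((gray X Y).degenerate_subset h).1,
      ((gray X Y).degenerate_subset h).2.imp
        (fun h' => X.isInvertible_of_degenerate h'.2)
        (fun h' => Y.isInvertible_of_degenerate h'.2)⟩

/-- The inclusion of `X ⊗ Y` in the product with the scaling `T_≃`. -/
def grayToGrayInv (X Y : ScaledSSet.{u}) : gray X Y ⟶ grayInv X Y :=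
  Hom.mk (𝟙 (X.toSSet ⊗ Y.toSSet)) (fun _ h =>
    ⟨h.1, h.2.imp (fun h' => X.isInvertible_of_degenerate h'.2)
      (fun h' => Y.isInvertible_of_degenerate h'.2)⟩)

/-- The underlying simplicial set of `X` with the scaling `L_X`: the thin triangles `σ` of `X`
such that `σ|Δ^{0,1}` or `σ|Δ^{1,2}` is invertible in `X`. An oplax functor from `X` to `E` is
a map of scaled simplicial sets `oplax X ⟶ E`. -/
def oplax (X : ScaledSSet.{u}) : ScaledSSet.{u} where
  toSSet := X.toSSet
  thin := {σ | σ ∈ X.thin ∧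
    (X.IsInvertible (X.toSSet.δ 2 σ) ∨ X.IsInvertible (X.toSSet.δ 0 σ))}
  degenerate_subset := fun σ h => by
    refine ⟨X.degenerate_subset h, ?_⟩
    rcases degenerate_triangle h with ⟨e, rfl⟩ | ⟨e, rfl⟩
    · exact Or.inl (X.isInvertible_of_degenerate (δ_two_σ_zero e))
    · exact Or.inr (X.isInvertible_of_degenerate (δ_zero_σ_one e))

/-- The scaling `L_{X × Y}` is contained in the scaling `T_≃`. -/
def oplaxToGrayInv (X Y : ScaledSSet.{u}) : oplax (prod X Y) ⟶ grayInv X Y :=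
  Hom.mk (𝟙 (X.toSSet ⊗ Y.toSSet)) (fun _ h =>
    ⟨h.1, h.2.symm.imp (fun h' => h'.map (prodFst X Y)) (fun h' => h'.map (prodSnd X Y))⟩)

/-! ## The ∞-bicategory of functors -/

/-- The mapping object `Fun(X, Y)`: its `n`-simplices are the maps of scaled simplicial sets
`Δⁿ_♭ × X ⟶ Y`, and a triangle `Δ²_♭ × X ⟶ Y` is thin if it factors through `Δ²_♯ × X`. -/
def functor (X Y : ScaledSSet.{u}) : ScaledSSet.{u} where
  toSSet :=
    { obj := fun n => prod (flat (SSet.stdSimplex.obj n.unop)) X ⟶ Y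
      map := fun g => ↾fun φ => prodMap (flatMap (SSet.stdSimplex.map g.unop)) (𝟙 X) ≫ φ
      map_id := fun n => by
        ext φ : 3
        change prodMap (flatMap (SSet.stdSimplex.map (𝟙 n).unop)) (𝟙 X) ≫ φ = φ
        apply hom_ext
        exact congrArg (fun k => (k ⊗ₘ 𝟙 X.toSSet) ≫ φ.hom)
          (CategoryTheory.Functor.map_id SSet.stdSimplex.{u} n.unop)
      map_comp := fun f g => by
        ext φ : 3
        change prodMap (flatMap (SSet.stdSimplex.map (f ≫ g).unop)) (𝟙 X) ≫ φ =
          prodMap (flatMap (SSet.stdSimplex.map g.unop)) (𝟙 X) ≫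
            prodMap (flatMap (SSet.stdSimplex.map f.unop)) (𝟙 X) ≫ φ
        apply hom_ext
        simp [prodMap, flatMap]
        rfl }
  thin := {φ | IsScaledMap (prod (sharp Δ[2]) X) Y
    (Hom.hom (X := prod (flat Δ[2]) X) (Y := Y) φ)}
  degenerate_subset := by
    intro φ hφ
    obtain ⟨m, hm, g, ψ, rfl⟩ := hφ
    rintro ⟨τ, σ⟩ ⟨-, hσ⟩
    refine Hom.isScaledMap ψ _ ⟨?_, hσ⟩
    change (SSet.stdSimplex.map g).app (op ⦋2⦌) τ ∈ (Δ[m] : SSet.{u}).degenerate 2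
    rw [SSet.degenerate_eq_univ_of_hasDimensionLT Δ[m] (m + 1) 2 (by omega)]
    trivial

/-- The restriction functor `Fun(Y, E) ⟶ Fun(X, E)` along a map `X ⟶ Y`. -/
def functorPrecomp {X Y : ScaledSSet.{u}} (f : X ⟶ Y) (E : ScaledSSet.{u}) :
    functor Y E ⟶ functor X E :=
  Hom.mk
    { app := fun n => ↾fun φ => prodMap (𝟙 (flat (SSet.stdSimplex.obj n.unop))) f ≫ φ
      naturality := fun n m g => by
        ext φ
        rfl }
    (fun φ hφ σ hσ => hφ (σ.1, f.hom.app _ σ.2) ⟨trivial, f.isScaledMap _ hσ.2⟩)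

/-- The vertices of `Fun(X, Y)` are the maps `X ⟶ Y`. -/
def functorVertex {X Y : ScaledSSet.{u}} : (X ⟶ Y) ≃ (functor X Y).toSSet _⦋0⦌ where
  toFun φ := prodSnd (flat Δ[0]) X ≫ φ
  invFun ψ :=
    Hom.mk (X := X) (Y := Y)
      (lift (SSet.const (SSet.stdSimplex.obj₀Equiv.symm 0)) (𝟙 X.toSSet) ≫
        Hom.hom (X := prod (flat Δ[0]) X) (Y := Y) ψ)
      (fun _ h => Hom.isScaledMap (X := prod (flat Δ[0]) X) (Y := Y) ψ _
        ⟨⟨0, by norm_num, SimplexCategory.const ⦋2⦌ ⦋0⦌ 0, _, rfl⟩, h⟩)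
  left_inv φ := rfl
  right_inv ψ := by
    apply hom_ext (X := prod (flat Δ[0]) X) (Y := Y)
    change snd Δ[0] X.toSSet ≫
      lift (SSet.const (SSet.stdSimplex.obj₀Equiv.symm 0)) (𝟙 X.toSSet) ≫
        Hom.hom (X := prod (flat Δ[0]) X) (Y := Y) ψ =
          𝟙 (Δ[0] ⊗ X.toSSet) ≫ Hom.hom (X := prod (flat Δ[0]) X) (Y := Y) ψ
    exact congrArg (fun k => k ≫ Hom.hom (X := prod (flat Δ[0]) X) (Y := Y) ψ)
      (CartesianMonoidalCategory.hom_ext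
        (snd Δ[0] X.toSSet ≫
          lift (SSet.const (SSet.stdSimplex.obj₀Equiv.symm 0)) (𝟙 X.toSSet))
        (𝟙 (Δ[0] ⊗ X.toSSet)) SSet.stdSimplex.ext₀ (by simp))

end ScaledSSet

/-! ## Marked simplicial sets and mapping ∞-categories -/

/-- A marked simplicial set: a simplicial set with a set of marked edges which contains all the
degenerate ones. -/
structure MarkedSSet : Type (u + 1) where
  /-- the underlying simplicial set -/
  toSSet : SSet.{u}
  /-- the marked edges -/
  marked : Set (toSSet _⦋1⦌)
  degenerate_subset : toSSet.degenerate 1 ⊆ marked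

namespace MarkedSSet

/-- Maps of marked simplicial sets. -/
@[ext]
structure Hom (X Y : MarkedSSet.{u}) where
  /-- the underlying map of simplicial sets -/
  hom : X.toSSet ⟶ Y.toSSet
  map_marked : ∀ e ∈ X.marked, hom.app (op ⦋1⦌) e ∈ Y.marked

instance : Category.{u} MarkedSSet.{u} where
  Hom := Hom
  id X := ⟨𝟙 X.toSSet, fun _ h => h⟩
  comp f g := ⟨f.hom ≫ g.hom, fun σ h => g.map_marked _ (f.map_marked σ h)⟩

/-- The product `J^♯ × X`, where `J` is the nerve of the walking isomorphism, all of whose edges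
are marked. -/
def cylinder (X : MarkedSSet.{u}) : MarkedSSet.{u} where
  toSSet := SSet.coherentIso.{u} ⊗ X.toSSet
  marked := {e | e.2 ∈ X.marked}
  degenerate_subset := fun _ h =>
    X.degenerate_subset (SSet.degenerate_app_apply h (snd SSet.coherentIso X.toSSet))

/-- The inclusion of `{v} × X` in `J^♯ × X`, for a vertex `v` of `J`. -/
def cylinderι (X : MarkedSSet.{u}) (v : SSet.coherentIso.{u} _⦋0⦌) : X ⟶ cylinder X :=
  Hom.mk (lift (SSet.const v) (𝟙 X.toSSet)) (fun _ h => h)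

/-- Two maps of marked simplicial sets are homotopic if they are the ends of a map out of
`J^♯ × X`. When `Y` is an ∞-category with its equivalences marked, this means that they are
equivalent objects of the ∞-category of functors. -/
def Homotopic {X Y : MarkedSSet.{u}} (f g : X ⟶ Y) : Prop :=
  ∃ H : cylinder X ⟶ Y,
    cylinderι X SSet.coherentIso.x₀ ≫ H = f ∧ cylinderι X SSet.coherentIso.x₁ ≫ H = g

/-- A map of marked simplicial sets is an equivalence if it has a homotopy inverse. Between
∞-categories with their equivalences marked (the fibrant marked simplicial sets), these are the
equivalences of ∞-categories, that is, the marked categorical equivalences. -/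
def IsEquivalence {X Y : MarkedSSet.{u}} (f : X ⟶ Y) : Prop :=
  ∃ g : Y ⟶ X, Homotopic (f ≫ g) (𝟙 X) ∧ Homotopic (g ≫ f) (𝟙 Y)

end MarkedSSet

namespace ScaledSSet

theorem map_tri {n m : ℕ} (g : ⦋n⦌ ⟶ ⦋m⦌) (a b c : Fin (n + 1)) (hab : a ≤ b) (hbc : b ≤ c) :
    (SSet.stdSimplex.{u}.map g).app (op ⦋2⦌) (tri a b c hab hbc) =
      tri (g.toOrderHom a) (g.toOrderHom b) (g.toOrderHom c)
        (g.toOrderHom.monotone hab) (g.toOrderHom.monotone hbc) := by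
  apply SSet.stdSimplex.ext
  intro i
  fin_cases i <;> rfl

/-- The condition for a map `f : Δⁿ × Δ¹ ⟶ C` to be an `n`-simplex of `Hom_C(x, y)`: it is
constant on `x` on `Δⁿ × {0}`, constant on `y` on `Δⁿ × {1}`, and the triangles
`Δ^{(i,0),(i,1),(j,1)}` are sent to thin triangles for `i ≤ j`. -/
structure IsMappingSimplex (C : ScaledSSet.{u}) (x y : C.toSSet _⦋0⦌) {n : ℕ}
    (f : Δ[n] ⊗ Δ[1] ⟶ C.toSSet) : Prop where
  source : lift (𝟙 Δ[n]) (SSet.const (SSet.stdSimplex.obj₀Equiv.symm 0)) ≫ f = SSet.const x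
  target : lift (𝟙 Δ[n]) (SSet.const (SSet.stdSimplex.obj₀Equiv.symm 1)) ≫ f = SSet.const y
  thin : ∀ (i j : Fin (n + 1)) (hij : i ≤ j),
    f.app (op ⦋2⦌) (tri i i j le_rfl hij, tri 0 1 1) ∈ C.thin

theorem IsMappingSimplex.precomp {C : ScaledSSet.{u}} {x y : C.toSSet _⦋0⦌} {n m : ℕ}
    {f : Δ[n] ⊗ Δ[1] ⟶ C.toSSet} (hf : C.IsMappingSimplex x y f) (g : ⦋m⦌ ⟶ ⦋n⦌) :
    C.IsMappingSimplex x y (SSet.stdSimplex.map g ▷ Δ[1] ≫ f) where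
  source := by
    have h := congrArg (fun k => SSet.stdSimplex.map g ≫ k) hf.source
    exact h
  target := by
    have h := congrArg (fun k => SSet.stdSimplex.map g ≫ k) hf.target
    exact h
  thin i j hij := by
    have h := hf.thin (g.toOrderHom i) (g.toOrderHom j) (g.toOrderHom.monotone hij)
    rw [← map_tri g i i j le_rfl hij] at h
    exact h

/-- The mapping ∞-category `Hom_C(x, y)`, as a marked simplicial set. An edge
`f : Δ¹ × Δ¹ ⟶ C` is marked when the triangle `Δ^{(0,0),(1,0),(1,1)}` is sent to a thin
triangle. -/
def mapping (C : ScaledSSet.{u}) (x y : C.toSSet _⦋0⦌) : MarkedSSet.{u} where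
  toSSet :=
    { obj := fun n => {f : Δ[n.unop.len] ⊗ Δ[1] ⟶ C.toSSet // C.IsMappingSimplex x y f}
      map := fun g => ↾fun f => ⟨SSet.stdSimplex.map g.unop ▷ Δ[1] ≫ f.1, f.2.precomp g.unop⟩
      map_id := fun n => by
        ext f : 3
        apply Subtype.ext
        exact congrArg (fun k => k ▷ Δ[1] ≫ f.1)
          (CategoryTheory.Functor.map_id SSet.stdSimplex.{u} n.unop)
      map_comp := fun f g => by
        ext φ : 3
        apply Subtype.ext
        exact congrArg (fun k => k ▷ Δ[1] ≫ φ.1)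
          (CategoryTheory.Functor.map_comp SSet.stdSimplex.{u} g.unop f.unop) }
  marked := {f | f.1.app (op ⦋2⦌) (tri 0 1 1, tri 0 0 1) ∈ C.thin}
  degenerate_subset := by
    intro f hf
    obtain ⟨m, hm, g, ψ, rfl⟩ := hf
    obtain rfl : m = 0 := by omega
    refine C.degenerate_subset (SSet.degenerate_app_apply
      (?_ : _ ∈ (Δ[0] ⊗ Δ[1] : SSet.{u}).degenerate 2) ψ.1)
    rw [SSet.degenerate_eq_univ_of_hasDimensionLT _ 2 2 le_rfl]
    trivial

/-- The map `Hom_C(x, y) ⟶ Hom_D(F x, F y)` induced by `F : C ⟶ D`. -/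
def mappingMap {C D : ScaledSSet.{u}} (F : C ⟶ D) (x y : C.toSSet _⦋0⦌) :
    mapping C x y ⟶ mapping D (F.hom.app (op ⦋0⦌) x) (F.hom.app (op ⦋0⦌) y) :=
  MarkedSSet.Hom.mk
    { app := fun n => ↾fun f => ⟨f.1 ≫ F.hom,
        ⟨by rw [← Category.assoc, f.2.source, SSet.const_comp],
          by rw [← Category.assoc, f.2.target, SSet.const_comp],
          fun i j hij => F.isScaledMap _ (f.2.thin i j hij)⟩⟩
      naturality := fun n m g => by
        ext φ
        rfl }
    (fun f hf => F.isScaledMap _ hf)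

/-- A functor of ∞-bicategories is fully faithful if it induces equivalences on mapping
∞-categories. -/
def FullyFaithful {C D : ScaledSSet.{u}} (F : C ⟶ D) : Prop :=
  ∀ x y : C.toSSet _⦋0⦌, MarkedSSet.IsEquivalence (mappingMap F x y)

/-- The essential image of a functor of ∞-bicategories: the objects `d` which are the target of
an invertible edge whose source is of the form `F c`. -/
def InEssentialImage {C D : ScaledSSet.{u}} (F : C ⟶ D) (d : D.toSSet _⦋0⦌) : Prop :=
  ∃ (c : C.toSSet _⦋0⦌) (e : D.toSSet.Edge (F.hom.app (op ⦋0⦌) c) d), D.IsInvertible e.edge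

/-! ## Oplax functors out of a product -/

/-- The restriction `Fun((C × D, T_≃), E) ⟶ Fun(C ⊗ D, E)`. -/
def grayInvRestriction (C D E : ScaledSSet.{u}) :
    functor (grayInv C D) E ⟶ functor (gray C D) E :=
  functorPrecomp (grayToGrayInv C D) E

/-- The ∞-bicategory `Fun_oplax(C, E)` of oplax functors from `C` to `E`. -/
abbrev functorOplax (C E : ScaledSSet.{u}) : ScaledSSet.{u} :=
  functor (oplax C) E

/-- The restriction functor `Fun(C ⊗ D, E) ≅ Fun((C × D, T_≃), E) ⟶ Fun_oplax(C × D, E)`. -/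
noncomputable def grayOplaxRestriction (C D E : ScaledSSet.{u})
    [IsIso (grayInvRestriction C D E)] :
    functor (gray C D) E ⟶ functorOplax (prod C D) E :=
  inv (grayInvRestriction C D E) ≫ functorPrecomp (oplaxToGrayInv C D) E

/-- The map of simplicial sets `D ⟶ E` given by restricting an oplax functor `φ` from `C × D`
to `E` to `{x} × D`. -/
def restrictLeft {C D E : ScaledSSet.{u}} (φ : oplax (prod C D) ⟶ E) (x : C.toSSet _⦋0⦌) :
    D.toSSet ⟶ E.toSSet :=
  lift (SSet.const x) (𝟙 D.toSSet) ≫ φ.hom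

/-- The map of simplicial sets `C ⟶ E` given by restricting an oplax functor `φ` from `C × D`
to `E` to `C × {y}`. -/
def restrictRight {C D E : ScaledSSet.{u}} (φ : oplax (prod C D) ⟶ E) (y : D.toSSet _⦋0⦌) :
    C.toSSet ⟶ E.toSSet :=
  lift (𝟙 C.toSSet) (SSet.const y) ≫ φ.hom

/-- For edges `f : x ⟶ x'` of `C` and `g : y ⟶ y'` of `D`, the triangle of `C × D` with
successive edges `(f, y) : (x, y) ⟶ (x', y)` and `(x', g) : (x', y) ⟶ (x', y')`, and with
third edge `(f, g)`. -/
def productTriangle (C D : ScaledSSet.{u}) (f : C.toSSet _⦋1⦌) (g : D.toSSet _⦋1⦌) :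
    (C.toSSet ⊗ D.toSSet) _⦋2⦌ :=
  (C.toSSet.σ 1 f, D.toSSet.σ 0 g)

end ScaledSSet

/-! All the functor objects involved have simplices that are maps `Δⁿ × (C × D) ⟶ E` of simplicial
sets, and they differ only in which triangles must become thin. Everything therefore reduces to
proving that certain triangles of `E` are thin, each time by exhibiting a simplex of dimension 3 or
4 in which the triangle is a face. A triangle 012 is viewed as a 2-cell from its edge 02 to the
composite of 01 and 12, invertible when thin. The saturation axiom is then two-out-of-six for
2-cells, and on degenerate 4-simplices it gives `thin_023` and `thin_013`: one of the faces 023, 013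
of a tetrahedron is thin once the three others are.

Isomorphism. Gray-thin triangles allow a pair `(α, β)` of thin triangles to be cut down, through
tetrahedra, to the triangle that runs first along the edge 01 of `β` and then along the edge 12 of
`α`. Its 2-cell is the interchange cell of the two edges. If one edge is invertible, the tetrahedron
of `exists_tetrahedron`, whose successive edges are the edge, an inverse and the edge again, makes
two-out-of-six applicable to interchange cells. For an edge of `D` the axiom applies as it stands;
for an edge of `C` its mirror form `saturation'` is needed. The argument is run with an extra factor
`K` (`isScaledMap_prod_grayInv`), so that it covers both the simplices and the thin triangles of the
functor objects; the inverse of the restriction is then the identity on underlying maps.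

Full faithfulness. A map on `Δⁿ × (C × D)` satisfying the oplax condition respects the Gray scaling
as soon as it does so over each vertex of `Δⁿ`. The restriction is thus the inclusion of all
simplices, and all thin triangles, on a set of vertices. It induces isomorphisms, not merely
equivalences, on mapping objects (`fullyFaithful_of_full`).

Essential image. Conditions (i) and (ii) characterise the strict image, again by cutting triangles
into tetrahedra (`isScaledMap_gray`). The strict image is closed under invertible edges, because
thinness is transported along an edge of the functor object that is invertible at the initial vertex
of the triangle (`thin_of_isInvertible`). -/

/-! ## Faces of simplices given by their vertices -/

namespace SSet

/-- The morphism of the simplex category given by a monotone list of vertices. -/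
def vertexMap {n m : ℕ} (v : Fin (m + 1) → Fin (n + 1))
    (hv : ∀ i j, i ≤ j → v i ≤ v j := by decide) : ⦋m⦌ ⟶ ⦋n⦌ :=
  SimplexCategory.mkHom ⟨v, fun i j h => hv i j h⟩

/-- The `m`-simplex of `X` whose vertices are the vertices `v 0, …, v m` of the simplex `x`. -/
def sub {X : SSet.{u}} {n m : ℕ} (x : X _⦋n⦌) (v : Fin (m + 1) → Fin (n + 1))
    (hv : ∀ i j, i ≤ j → v i ≤ v j := by decide) : X _⦋m⦌ :=
  X.map (vertexMap v hv).op x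

theorem vertexMap_eq {n m : ℕ} (g : ⦋m⦌ ⟶ ⦋n⦌) :
    g = vertexMap g.toOrderHom (fun _ _ h => g.toOrderHom.monotone h) := by
  ext
  rfl

theorem map_eq_sub {X : SSet.{u}} {n m : ℕ} (x : X _⦋n⦌) (g : ⦋m⦌ ⟶ ⦋n⦌) :
    X.map g.op x = sub x g.toOrderHom (fun _ _ h => g.toOrderHom.monotone h) :=
  congrArg (fun k => X.map k.op x) (vertexMap_eq g)

theorem sub_sub {X : SSet.{u}} {n m k : ℕ} (x : X _⦋n⦌) {v : Fin (m + 1) → Fin (n + 1)} {hv}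
    {w : Fin (k + 1) → Fin (m + 1)} {hw} :
    sub (sub x v hv) w hw = sub x (v ∘ w) (fun i j h => hv _ _ (hw i j h)) := by
  unfold sub
  rw [← Functor.map_comp_apply, ← op_comp]
  rfl

theorem sub_congr {X : SSet.{u}} {n m : ℕ} (x : X _⦋n⦌) {v w : Fin (m + 1) → Fin (n + 1)} {hv}
    (h : v = w) : sub x v hv = sub x w (h ▸ hv) := by
  subst h
  rfl

/-- Iterated faces, with the composite list of vertices made explicit. -/
theorem sub_sub_eq {X : SSet.{u}} {n m k : ℕ} (x : X _⦋n⦌) {v : Fin (m + 1) → Fin (n + 1)} {hv}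
    {w : Fin (k + 1) → Fin (m + 1)} {hw} {u : Fin (k + 1) → Fin (n + 1)} {hu}
    (h : ∀ i, v (w i) = u i := by decide) :
    sub (sub x v hv) w hw = sub x u hu := by
  rw [sub_sub]
  exact sub_congr x (funext h)

theorem sub_self {X : SSet.{u}} {n : ℕ} (x : X _⦋n⦌) {v : Fin (n + 1) → Fin (n + 1)} {hv}
    (h : ∀ i, v i = i := by decide) : sub x v hv = x := by
  obtain rfl : v = id := funext h
  have h : vertexMap (id : Fin (n + 1) → Fin (n + 1)) hv = 𝟙 ⦋n⦌ := by
    ext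
    rfl
  unfold sub
  rw [h, op_id, X.map_id_apply]

theorem δ_eq_sub {X : SSet.{u}} {n : ℕ} (x : X _⦋n + 1⦌) (i : Fin (n + 2))
    {v : Fin (n + 1) → Fin (n + 2)} {hv}
    (h : ∀ j, i.succAbove j = v j := by decide) : X.δ i x = sub x v hv := by
  obtain rfl : i.succAbove = v := funext h
  rfl

theorem σ_eq_sub {X : SSet.{u}} {n : ℕ} (x : X _⦋n⦌) (i : Fin (n + 1))
    {v : Fin (n + 2) → Fin (n + 1)} {hv}
    (h : ∀ j, i.predAbove j = v j := by decide) : X.σ i x = sub x v hv := by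
  obtain rfl : i.predAbove = v := funext h
  rfl

theorem app_sub {X Y : SSet.{u}} (f : X ⟶ Y) {n m : ℕ} (x : X _⦋n⦌)
    (v : Fin (m + 1) → Fin (n + 1)) (hv) :
    f.app (op ⦋m⦌) (sub x v hv) = sub (f.app (op ⦋n⦌) x) v hv :=
  NatTrans.naturality_apply f _ _

theorem sub_mem_degenerate {X : SSet.{u}} {n m : ℕ} (x : X _⦋n⦌)
    {v : Fin (m + 1) → Fin (n + 1)} {hv} (i : Fin m) (h : v i.castSucc = v i.succ := by decide) :
    sub x v hv ∈ X.degenerate m := by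
  obtain _ | m := m
  · exact i.elim0
  -- A map with equal values at `i` and `i + 1` is unchanged by first collapsing these two vertices
  -- and then reinserting `i + 1`.
  · have hσ : vertexMap v hv =
        SimplexCategory.σ i ≫ SimplexCategory.δ i.castSucc ≫ vertexMap v hv := by
      ext j
      refine congrArg Fin.val (?_ : v j = v (i.castSucc.succAbove (i.predAbove j)))
      by_cases hj : j = i.castSucc
      · subst hj
        rw [Fin.predAbove_castSucc_self, Fin.succAbove_castSucc_self, h]
      · rw [Fin.succAbove_predAbove hj]
    unfold sub
    rw [hσ, op_comp, Functor.map_comp_apply]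
    exact σ_mem_degenerate _ i _

end SSet

/-! ### The extension properties in terms of simplices. -/

namespace ScaledSSet

open SSet

/-- The extension property with respect to the saturation axiom. -/
theorem IsInfBicategory.saturation {E : ScaledSSet.{u}} (hE : E.IsInfBicategory)
    (t : E.toSSet _⦋4⦌)
    (h024 : sub t ![0, 2, 4] ∈ E.thin) (h123 : sub t ![1, 2, 3] ∈ E.thin)
    (h013 : sub t ![0, 1, 3] ∈ E.thin) (h134 : sub t ![1, 3, 4] ∈ E.thin)
    (h012 : sub t ![0, 1, 2] ∈ E.thin) :
    sub t ![0, 3, 4] ∈ E.thin ∧ sub t ![0, 1, 4] ∈ E.thin := by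
  obtain ⟨g, hg⟩ := hE _ .saturation (Hom.mk (yonedaEquiv.symm t) (by
    rintro σ (hσ | hσ)
    · exact E.degenerate_subset (degenerate_app_apply hσ _)
    · rcases hσ with rfl | rfl | rfl | rfl | rfl
      exacts [h024, h123, h013, h134, h012]))
  have hg' : g.hom = yonedaEquiv.symm t := by
    exact (Category.id_comp g.hom).symm.trans (congrArg Hom.hom hg)
  have key : ∀ a b c hab hbc, tri a b c hab hbc ∈ (withThin.{u} Δ[4] saturationTarget).thin →
      (yonedaEquiv.symm t).app (op ⦋2⦌) (tri a b c hab hbc) ∈ E.thin := by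
    intro a b c hab hbc h
    rw [← hg']
    exact g.isScaledMap _ h
  exact ⟨key 0 3 4 (by decide) (by decide) (Or.inr (Or.inr (Or.inl rfl))),
    key 0 1 4 (by decide) (by decide) (Or.inr (Or.inr (Or.inr rfl)))⟩

theorem thin_of_eq {E : ScaledSSet.{u}} {x y : E.toSSet _⦋2⦌} (h : x ∈ E.thin) (e : x = y) :
    y ∈ E.thin := e ▸ h

theorem sub_thin_of_degenerate (E : ScaledSSet.{u}) {n : ℕ} (x : E.toSSet _⦋n⦌)
    {v : Fin 3 → Fin (n + 1)} {hv} (h : v 0 = v 1 ∨ v 1 = v 2 := by decide) :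
    sub x v hv ∈ E.thin := by
  rcases h with h | h
  · exact E.degenerate_subset (sub_mem_degenerate x 0 h)
  · exact E.degenerate_subset (sub_mem_degenerate x 1 h)

/-- Saturation for the degenerate 4-simplex 01123: its triangles 123 and 012 are degenerate, the
other hypotheses are the given faces, and its triangle 034 is the face 023. -/
theorem IsInfBicategory.thin_023 {E : ScaledSSet.{u}} (hE : E.IsInfBicategory)
    (t : E.toSSet _⦋3⦌) (h012 : sub t ![0, 1, 2] ∈ E.thin) (h013 : sub t ![0, 1, 3] ∈ E.thin)
    (h123 : sub t ![1, 2, 3] ∈ E.thin) : sub t ![0, 2, 3] ∈ E.thin := by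
  have h := hE.saturation (sub t ![0, 1, 1, 2, 3]) (thin_of_eq h013 (sub_sub_eq _).symm)
    (by rw [sub_sub]; exact E.sub_thin_of_degenerate t)
    (thin_of_eq h012 (sub_sub_eq _).symm) (thin_of_eq h123 (sub_sub_eq _).symm)
    (by rw [sub_sub]; exact E.sub_thin_of_degenerate t)
  exact thin_of_eq h.1 (sub_sub_eq _)

/-- Saturation for the degenerate 4-simplex 01223, whose triangle 014 is the face 013. -/
theorem IsInfBicategory.thin_013 {E : ScaledSSet.{u}} (hE : E.IsInfBicategory)
    (t : E.toSSet _⦋3⦌) (h012 : sub t ![0, 1, 2] ∈ E.thin) (h023 : sub t ![0, 2, 3] ∈ E.thin)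
    (h123 : sub t ![1, 2, 3] ∈ E.thin) : sub t ![0, 1, 3] ∈ E.thin := by
  have h := hE.saturation (sub t ![0, 1, 2, 2, 3]) (thin_of_eq h023 (sub_sub_eq _).symm)
    (by rw [sub_sub]; exact E.sub_thin_of_degenerate t)
    (thin_of_eq h012 (sub_sub_eq _).symm) (thin_of_eq h123 (sub_sub_eq _).symm)
    (thin_of_eq h012 (sub_sub_eq _).symm)
  exact thin_of_eq h.2 (sub_sub_eq _)

theorem exists_δ_of_mem_horn {n : ℕ} {i : Fin (n + 2)} {m : SimplexCategoryᵒᵖ}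
    {σ : (Δ[n + 1] : SSet.{u}).obj m} (hσ : σ ∈ (horn (n + 1) i).obj m) :
    ∃ (j : Fin (n + 2)) (_ : j ≠ i) (z : (Δ[n] : SSet.{u}).obj m),
      (stdSimplex.δ j).app m z = σ := by
  rw [horn_eq_iSup, Subfunctor.iSup_obj, Set.mem_iUnion] at hσ
  obtain ⟨⟨j, hj⟩, hσ⟩ := hσ
  rw [← stdSimplex.ofSimplex_yonedaEquiv_δ, ← Subcomplex.range_eq_ofSimplex] at hσ
  exact ⟨j, hj, hσ⟩

/-- The extension property with respect to inner horns, in terms of simplices. -/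
theorem IsInfBicategory.exists_filler {E : ScaledSSet.{u}} (hE : E.IsInfBicategory)
    {n : ℕ} (i : Fin (n + 1))
    (y : ∀ j : Fin (n + 3), j ≠ i.succ.castSucc → E.toSSet _⦋n + 1⦌)
    (hy : ∀ (j k : Fin (n + 3)) (hj : j ≠ i.succ.castSucc) (hk : k ≠ i.succ.castSucc)
      (hjk : j < k), E.toSSet.δ (k.pred (Fin.ne_zero_of_lt hjk)) (y j hj) =
        E.toSSet.δ (j.castPred (Fin.ne_last_of_lt hjk)) (y k hk))
    (hthin : ∀ (j : Fin (n + 3)) (hj : j ≠ i.succ.castSucc) (w : Fin 3 → Fin (n + 2)) (hw),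
      j.succAbove (w 0) = i.castSucc.castSucc → j.succAbove (w 1) = i.succ.castSucc →
        j.succAbove (w 2) = i.succ.succ → sub (y j hj) w hw ∈ E.thin) :
    ∃ t : E.toSSet _⦋n + 2⦌, (∀ j hj, E.toSSet.δ j t = y j hj) ∧
      ∀ (v : Fin 3 → Fin (n + 3)) (hv), v 0 = i.castSucc.castSucc → v 1 = i.succ.castSucc →
        v 2 = i.succ.succ → sub t v hv ∈ E.thin := by
  have hc : horn.IsCompatible (i := i.succ.castSucc)
      (fun j hj => (yonedaEquiv.symm (y j hj) : Δ[n + 1] ⟶ E.toSSet)) := by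
    rw [horn.isCompatible_iff]
    intro j k hj hk hjk
    exact (stdSimplex.δ_comp_yonedaEquiv_symm _ _).trans
      ((congrArg yonedaEquiv.symm (hy j k hj hk hjk)).trans
        (stdSimplex.δ_comp_yonedaEquiv_symm _ _).symm)
  obtain ⟨g, hg⟩ := hE _ (.inner n i) (Hom.mk hc.desc (by
    rintro ⟨σ, hσ⟩ (h | h)
    · exact E.degenerate_subset (degenerate_app_apply
        ((Subcomplex.mem_degenerate_iff _ _).2 h) _)
    -- The marked triangle, if it lies in the horn, lies in some face `j`. Its position `z` in that
    -- face has exactly the vertices required by `hthin`.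
    · obtain ⟨j, hj, z, hz⟩ : ∃ (j : Fin (n + 3)) (_ : j ≠ i.succ.castSucc)
          (z : (Δ[n + 1] : SSet.{u}) _⦋2⦌), (stdSimplex.δ j).app (op ⦋2⦌) z = σ :=
        exists_δ_of_mem_horn hσ
      have e : (⟨σ, hσ⟩ : (horn.{u} (n + 2) i.succ.castSucc : SSet.{u}) _⦋2⦌) =
          (horn.ι _ j hj).app (op ⦋2⦌) z :=
        Subtype.ext (hz.symm.trans
          (ConcreteCategory.congr_hom (congr_app (horn.ι_ι _ j hj) (op ⦋2⦌)) z).symm)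
      have e' := ConcreteCategory.congr_hom (congr_app (hc.ι_desc j hj) (op ⦋2⦌)) z
      change hc.desc.app (op ⦋2⦌) ⟨σ, hσ⟩ ∈ E.thin
      rw [e]
      refine thin_of_eq (thin_of_eq (hthin j hj (stdSimplex.objEquiv z).toOrderHom
        (fun _ _ h => (stdSimplex.objEquiv z).toOrderHom.monotone h) ?_ ?_ ?_)
          (map_eq_sub _ (stdSimplex.objEquiv z)).symm) e'.symm
      · exact congrArg (fun (x : (Δ[n + 2] : SSet.{u}) _⦋2⦌) => x 0)
          (hz.trans (Set.eq_of_mem_singleton h))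
      · exact congrArg (fun (x : (Δ[n + 2] : SSet.{u}) _⦋2⦌) => x 1)
          (hz.trans (Set.eq_of_mem_singleton h))
      · exact congrArg (fun (x : (Δ[n + 2] : SSet.{u}) _⦋2⦌) => x 2)
          (hz.trans (Set.eq_of_mem_singleton h))))
  refine ⟨SSet.yonedaEquiv g.hom, fun j hj => ?_, fun v hv h0 h1 h2 => ?_⟩
  · have h : stdSimplex.δ j ≫ g.hom = yonedaEquiv.symm (y j hj) := by
      rw [← hc.ι_desc j hj, ← horn.ι_ι _ j hj]
      exact congrArg (fun k => horn.ι _ j hj ≫ Hom.hom k) hg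
    exact (stdSimplex.yonedaEquiv_δ_comp g.hom j).symm.trans
      ((congrArg SSet.yonedaEquiv h).trans (SSet.yonedaEquiv.apply_symm_apply _))
  · have h := g.isScaledMap _ (Or.inr rfl)
    have e := congrArg (fun k : Δ[n + 2] ⟶ E.toSSet => k.app (op ⦋2⦌)
      (tri i.castSucc.castSucc i.succ.castSucc i.succ.succ (by simp [Fin.le_def])
        (by simp [Fin.le_def]))) (SSet.yonedaEquiv.symm_apply_apply g.hom)
    refine thin_of_eq h (e.symm.trans ((map_eq_sub _ _).trans (sub_congr _ ?_)))
    funext k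
    fin_cases k
    exacts [h0.symm, h1.symm, h2.symm]

variable {E : ScaledSSet.{u}}

/-! ## Inner horns of dimension at most four -/

theorem IsInfBicategory.fill₂ (hE : E.IsInfBicategory) (a b : E.toSSet _⦋1⦌)
    (h : sub a ![1] = sub b ![0]) :
    ∃ t ∈ E.thin, sub t ![0, 1] = a ∧ sub t ![1, 2] = b := by
  have e : E.toSSet.δ 1 b = E.toSSet.δ 0 a :=
    (δ_eq_sub _ _).trans (h.symm.trans (δ_eq_sub _ _).symm)
  obtain ⟨t, h1, h2⟩ := hE.exists_filler (n := 0) 0 (fun j _ => ![b, b, a] j) (by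
    intro j k hj hk hjk
    fin_cases j <;> fin_cases k <;>
      first
      | exact absurd hjk (by decide)
      | exact (hj rfl).elim
      | exact (hk rfl).elim
      | exact e) (by
    intro j hj w hw h0 h1 h2
    fin_cases j
    exacts [absurd h0 (Fin.succAbove_ne _ _), absurd h1 (Fin.succAbove_ne _ _),
      absurd h2 (Fin.succAbove_ne _ _)])
  exact ⟨t, sub_self t (v := ![0, 1, 2]) (hv := by decide) ▸ h2 _ _ rfl rfl rfl,
    (δ_eq_sub _ 2).symm.trans (h1 2 (by decide)), (δ_eq_sub _ 0).symm.trans (h1 0 (by decide))⟩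

theorem thin_of_three_vertices {n : ℕ} {x : E.toSSet _⦋n⦌} {v w : Fin 3 → Fin (n + 1)} {hv hw}
    (h : sub x v hv ∈ E.thin) (h0 : w 0 = v 0) (h1 : w 1 = v 1) (h2 : w 2 = v 2) :
    sub x w hw ∈ E.thin := by
  refine thin_of_eq h (sub_congr x ?_)
  funext k
  fin_cases k
  exacts [h0.symm, h1.symm, h2.symm]

/-- Fillers of `Λ³₁`. -/
theorem IsInfBicategory.fill₃₁ (hE : E.IsInfBicategory) (d0 d2 d3 : E.toSSet _⦋2⦌)
    (h3 : d3 ∈ E.thin) (h12 : sub d0 ![0, 1] = sub d3 ![1, 2])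
    (h13 : sub d0 ![0, 2] = sub d2 ![1, 2]) (h01 : sub d2 ![0, 1] = sub d3 ![0, 1]) :
    ∃ t : E.toSSet _⦋3⦌, sub t ![1, 2, 3] = d0 ∧ sub t ![0, 1, 3] = d2 ∧
      sub t ![0, 1, 2] = d3 := by
  have e12 : E.toSSet.δ 2 d0 = E.toSSet.δ 0 d3 :=
    (δ_eq_sub _ _).trans (h12.trans (δ_eq_sub _ _).symm)
  have e13 : E.toSSet.δ 1 d0 = E.toSSet.δ 0 d2 :=
    (δ_eq_sub _ _).trans (h13.trans (δ_eq_sub _ _).symm)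
  have e01 : E.toSSet.δ 2 d2 = E.toSSet.δ 2 d3 :=
    (δ_eq_sub _ _).trans (h01.trans (δ_eq_sub _ _).symm)
  obtain ⟨t, h1, -⟩ := hE.exists_filler (n := 1) 0 (fun j _ => ![d0, d0, d2, d3] j) (by
    intro j k hj hk hjk
    fin_cases j <;> fin_cases k <;>
      first
      | exact absurd hjk (by decide)
      | exact (hj rfl).elim
      | exact (hk rfl).elim
      | exact e12
      | exact e13
      | exact e01) (by
    intro j hj w hw e0 e1 e2
    fin_cases j
    · exact absurd e0 (Fin.succAbove_ne _ _)
    · exact absurd e1 (Fin.succAbove_ne _ _)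
    · exact absurd e2 (Fin.succAbove_ne _ _)
    · refine thin_of_eq h3 (sub_self d3 ?_).symm
      intro k
      apply Fin.succAbove_right_injective (p := (3 : Fin 4))
      fin_cases k
      exacts [e0, e1, e2])
  exact ⟨t, (δ_eq_sub _ 0).symm.trans (h1 0 (by decide)),
    (δ_eq_sub _ 2).symm.trans (h1 2 (by decide)), (δ_eq_sub _ 3).symm.trans (h1 3 (by decide))⟩

/-- Fillers of `Λ³₂`. -/
theorem IsInfBicategory.fill₃₂ (hE : E.IsInfBicategory) (d0 d1 d3 : E.toSSet _⦋2⦌)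
    (h0 : d0 ∈ E.thin) (h12 : sub d0 ![0, 1] = sub d3 ![1, 2])
    (h23 : sub d0 ![1, 2] = sub d1 ![1, 2]) (h02 : sub d1 ![0, 1] = sub d3 ![0, 2]) :
    ∃ t : E.toSSet _⦋3⦌, sub t ![1, 2, 3] = d0 ∧ sub t ![0, 2, 3] = d1 ∧
      sub t ![0, 1, 2] = d3 := by
  have e12 : E.toSSet.δ 2 d0 = E.toSSet.δ 0 d3 :=
    (δ_eq_sub _ _).trans (h12.trans (δ_eq_sub _ _).symm)
  have e23 : E.toSSet.δ 0 d0 = E.toSSet.δ 0 d1 :=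
    (δ_eq_sub _ _).trans (h23.trans (δ_eq_sub _ _).symm)
  have e02 : E.toSSet.δ 2 d1 = E.toSSet.δ 1 d3 :=
    (δ_eq_sub _ _).trans (h02.trans (δ_eq_sub _ _).symm)
  obtain ⟨t, h1, -⟩ := hE.exists_filler (n := 1) 1 (fun j _ => ![d0, d1, d0, d3] j) (by
    intro j k hj hk hjk
    fin_cases j <;> fin_cases k <;>
      first
      | exact absurd hjk (by decide)
      | exact (hj rfl).elim
      | exact (hk rfl).elim
      | exact e12
      | exact e23
      | exact e02) (by
    intro j hj w hw e0 e1 e2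
    fin_cases j
    · refine thin_of_eq h0 (sub_self d0 ?_).symm
      intro k
      apply Fin.succAbove_right_injective (p := (0 : Fin 4))
      fin_cases k
      exacts [e0, e1, e2]
    · exact absurd e0 (Fin.succAbove_ne _ _)
    · exact absurd e1 (Fin.succAbove_ne _ _)
    · exact absurd e2 (Fin.succAbove_ne _ _))
  exact ⟨t, (δ_eq_sub _ 0).symm.trans (h1 0 (by decide)),
    (δ_eq_sub _ 1).symm.trans (h1 1 (by decide)), (δ_eq_sub _ 3).symm.trans (h1 3 (by decide))⟩

/-- Fillers of `Λ⁴₁`. -/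
theorem IsInfBicategory.fill₄₁ (hE : E.IsInfBicategory) (d0 d2 d3 d4 : E.toSSet _⦋3⦌)
    (hthin : sub d4 ![0, 1, 2] ∈ E.thin)
    (h02 : sub d0 ![0, 2, 3] = sub d2 ![1, 2, 3]) (h03 : sub d0 ![0, 1, 3] = sub d3 ![1, 2, 3])
    (h04 : sub d0 ![0, 1, 2] = sub d4 ![1, 2, 3]) (h23 : sub d2 ![0, 1, 3] = sub d3 ![0, 1, 3])
    (h24 : sub d2 ![0, 1, 2] = sub d4 ![0, 1, 3]) (h34 : sub d3 ![0, 1, 2] = sub d4 ![0, 1, 2]) :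
    ∃ t : E.toSSet _⦋4⦌, sub t ![1, 2, 3, 4] = d0 ∧ sub t ![0, 1, 3, 4] = d2 ∧
      sub t ![0, 1, 2, 4] = d3 ∧ sub t ![0, 1, 2, 3] = d4 := by
  have e02 : E.toSSet.δ 1 d0 = E.toSSet.δ 0 d2 :=
    (δ_eq_sub _ _).trans (h02.trans (δ_eq_sub _ _).symm)
  have e03 : E.toSSet.δ 2 d0 = E.toSSet.δ 0 d3 :=
    (δ_eq_sub _ _).trans (h03.trans (δ_eq_sub _ _).symm)
  have e04 : E.toSSet.δ 3 d0 = E.toSSet.δ 0 d4 :=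
    (δ_eq_sub _ _).trans (h04.trans (δ_eq_sub _ _).symm)
  have e23 : E.toSSet.δ 2 d2 = E.toSSet.δ 2 d3 :=
    (δ_eq_sub _ _).trans (h23.trans (δ_eq_sub _ _).symm)
  have e24 : E.toSSet.δ 3 d2 = E.toSSet.δ 2 d4 :=
    (δ_eq_sub _ _).trans (h24.trans (δ_eq_sub _ _).symm)
  have e34 : E.toSSet.δ 3 d3 = E.toSSet.δ 3 d4 :=
    (δ_eq_sub _ _).trans (h34.trans (δ_eq_sub _ _).symm)
  obtain ⟨t, h1, -⟩ := hE.exists_filler (n := 2) 0 (fun j _ => ![d0, d0, d2, d3, d4] j) (by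
    intro j k hj hk hjk
    fin_cases j <;> fin_cases k <;>
      first
      | exact absurd hjk (by decide)
      | exact (hj rfl).elim
      | exact (hk rfl).elim
      | exact e02
      | exact e03
      | exact e04
      | exact e23
      | exact e24
      | exact e34) (by
    intro j hj w hw e0 e1 e2
    fin_cases j
    · exact absurd e0 (Fin.succAbove_ne _ _)
    · exact absurd e1 (Fin.succAbove_ne _ _)
    · exact absurd e2 (Fin.succAbove_ne _ _)
    · exact thin_of_three_vertices (v := ![0, 1, 2]) (thin_of_eq hthin h34.symm)
        (Fin.succAbove_right_injective (p := (3 : Fin 5)) e0)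
        (Fin.succAbove_right_injective (p := (3 : Fin 5)) e1)
        (Fin.succAbove_right_injective (p := (3 : Fin 5)) e2)
    · exact thin_of_three_vertices hthin
        (Fin.succAbove_right_injective (p := (4 : Fin 5)) e0)
        (Fin.succAbove_right_injective (p := (4 : Fin 5)) e1)
        (Fin.succAbove_right_injective (p := (4 : Fin 5)) e2))
  exact ⟨t, (δ_eq_sub _ 0).symm.trans (h1 0 (by decide)),
    (δ_eq_sub _ 2).symm.trans (h1 2 (by decide)), (δ_eq_sub _ 3).symm.trans (h1 3 (by decide)),
    (δ_eq_sub _ 4).symm.trans (h1 4 (by decide))⟩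

/-- Fillers of `Λ⁴₂`. -/
theorem IsInfBicategory.fill₄₂ (hE : E.IsInfBicategory) (d0 d1 d3 d4 : E.toSSet _⦋3⦌)
    (hthin : sub d4 ![1, 2, 3] ∈ E.thin)
    (h01 : sub d0 ![1, 2, 3] = sub d1 ![1, 2, 3]) (h03 : sub d0 ![0, 1, 3] = sub d3 ![1, 2, 3])
    (h04 : sub d0 ![0, 1, 2] = sub d4 ![1, 2, 3]) (h13 : sub d1 ![0, 1, 3] = sub d3 ![0, 2, 3])
    (h14 : sub d1 ![0, 1, 2] = sub d4 ![0, 2, 3]) (h34 : sub d3 ![0, 1, 2] = sub d4 ![0, 1, 2]) :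
    ∃ t : E.toSSet _⦋4⦌, sub t ![1, 2, 3, 4] = d0 ∧ sub t ![0, 2, 3, 4] = d1 ∧
      sub t ![0, 1, 2, 4] = d3 ∧ sub t ![0, 1, 2, 3] = d4 := by
  have e01 : E.toSSet.δ 0 d0 = E.toSSet.δ 0 d1 :=
    (δ_eq_sub _ _).trans (h01.trans (δ_eq_sub _ _).symm)
  have e03 : E.toSSet.δ 2 d0 = E.toSSet.δ 0 d3 :=
    (δ_eq_sub _ _).trans (h03.trans (δ_eq_sub _ _).symm)
  have e04 : E.toSSet.δ 3 d0 = E.toSSet.δ 0 d4 :=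
    (δ_eq_sub _ _).trans (h04.trans (δ_eq_sub _ _).symm)
  have e13 : E.toSSet.δ 2 d1 = E.toSSet.δ 1 d3 :=
    (δ_eq_sub _ _).trans (h13.trans (δ_eq_sub _ _).symm)
  have e14 : E.toSSet.δ 3 d1 = E.toSSet.δ 1 d4 :=
    (δ_eq_sub _ _).trans (h14.trans (δ_eq_sub _ _).symm)
  have e34 : E.toSSet.δ 3 d3 = E.toSSet.δ 3 d4 :=
    (δ_eq_sub _ _).trans (h34.trans (δ_eq_sub _ _).symm)
  obtain ⟨t, h1, -⟩ := hE.exists_filler (n := 2) 1 (fun j _ => ![d0, d1, d0, d3, d4] j) (by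
    intro j k hj hk hjk
    fin_cases j <;> fin_cases k <;>
      first
      | exact absurd hjk (by decide)
      | exact (hj rfl).elim
      | exact (hk rfl).elim
      | exact e01
      | exact e03
      | exact e04
      | exact e13
      | exact e14
      | exact e34) (by
    intro j hj w hw e0 e1 e2
    fin_cases j
    · exact thin_of_three_vertices (v := ![0, 1, 2]) (thin_of_eq hthin h04.symm)
        (Fin.succAbove_right_injective (p := (0 : Fin 5)) e0)
        (Fin.succAbove_right_injective (p := (0 : Fin 5)) e1)
        (Fin.succAbove_right_injective (p := (0 : Fin 5)) e2)
    · exact absurd e0 (Fin.succAbove_ne _ _)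
    · exact absurd e1 (Fin.succAbove_ne _ _)
    · exact absurd e2 (Fin.succAbove_ne _ _)
    · exact thin_of_three_vertices hthin
        (Fin.succAbove_right_injective (p := (4 : Fin 5)) e0)
        (Fin.succAbove_right_injective (p := (4 : Fin 5)) e1)
        (Fin.succAbove_right_injective (p := (4 : Fin 5)) e2))
  exact ⟨t, (δ_eq_sub _ 0).symm.trans (h1 0 (by decide)),
    (δ_eq_sub _ 1).symm.trans (h1 1 (by decide)), (δ_eq_sub _ 3).symm.trans (h1 3 (by decide)),
    (δ_eq_sub _ 4).symm.trans (h1 4 (by decide))⟩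

/-- Fillers of `Λ⁴₃`. -/
theorem IsInfBicategory.fill₄₃ (hE : E.IsInfBicategory) (d0 d1 d2 d4 : E.toSSet _⦋3⦌)
    (hthin : sub d0 ![1, 2, 3] ∈ E.thin)
    (h01 : sub d0 ![1, 2, 3] = sub d1 ![1, 2, 3]) (h02 : sub d0 ![0, 2, 3] = sub d2 ![1, 2, 3])
    (h04 : sub d0 ![0, 1, 2] = sub d4 ![1, 2, 3]) (h12 : sub d1 ![0, 2, 3] = sub d2 ![0, 2, 3])
    (h14 : sub d1 ![0, 1, 2] = sub d4 ![0, 2, 3]) (h24 : sub d2 ![0, 1, 2] = sub d4 ![0, 1, 3]) :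
    ∃ t : E.toSSet _⦋4⦌, sub t ![1, 2, 3, 4] = d0 ∧ sub t ![0, 2, 3, 4] = d1 ∧
      sub t ![0, 1, 3, 4] = d2 ∧ sub t ![0, 1, 2, 3] = d4 := by
  have e01 : E.toSSet.δ 0 d0 = E.toSSet.δ 0 d1 :=
    (δ_eq_sub _ _).trans (h01.trans (δ_eq_sub _ _).symm)
  have e02 : E.toSSet.δ 1 d0 = E.toSSet.δ 0 d2 :=
    (δ_eq_sub _ _).trans (h02.trans (δ_eq_sub _ _).symm)
  have e04 : E.toSSet.δ 3 d0 = E.toSSet.δ 0 d4 :=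
    (δ_eq_sub _ _).trans (h04.trans (δ_eq_sub _ _).symm)
  have e12 : E.toSSet.δ 1 d1 = E.toSSet.δ 1 d2 :=
    (δ_eq_sub _ _).trans (h12.trans (δ_eq_sub _ _).symm)
  have e14 : E.toSSet.δ 3 d1 = E.toSSet.δ 1 d4 :=
    (δ_eq_sub _ _).trans (h14.trans (δ_eq_sub _ _).symm)
  have e24 : E.toSSet.δ 3 d2 = E.toSSet.δ 2 d4 :=
    (δ_eq_sub _ _).trans (h24.trans (δ_eq_sub _ _).symm)
  obtain ⟨t, h1, -⟩ := hE.exists_filler (n := 2) 2 (fun j _ => ![d0, d1, d2, d0, d4] j) (by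
    intro j k hj hk hjk
    fin_cases j <;> fin_cases k <;>
      first
      | exact absurd hjk (by decide)
      | exact (hj rfl).elim
      | exact (hk rfl).elim
      | exact e01
      | exact e02
      | exact e04
      | exact e12
      | exact e14
      | exact e24) (by
    intro j hj w hw e0 e1 e2
    fin_cases j
    · exact thin_of_three_vertices hthin
        (Fin.succAbove_right_injective (p := (0 : Fin 5)) e0)
        (Fin.succAbove_right_injective (p := (0 : Fin 5)) e1)
        (Fin.succAbove_right_injective (p := (0 : Fin 5)) e2)
    · exact thin_of_three_vertices (v := ![1, 2, 3]) (thin_of_eq hthin h01)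
        (Fin.succAbove_right_injective (p := (1 : Fin 5)) e0)
        (Fin.succAbove_right_injective (p := (1 : Fin 5)) e1)
        (Fin.succAbove_right_injective (p := (1 : Fin 5)) e2)
    · exact absurd e0 (Fin.succAbove_ne _ _)
    · exact absurd e1 (Fin.succAbove_ne _ _)
    · exact absurd e2 (Fin.succAbove_ne _ _))
  exact ⟨t, (δ_eq_sub _ 0).symm.trans (h1 0 (by decide)),
    (δ_eq_sub _ 1).symm.trans (h1 1 (by decide)), (δ_eq_sub _ 2).symm.trans (h1 2 (by decide)),
    (δ_eq_sub _ 4).symm.trans (h1 4 (by decide))⟩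

/-! ## Cancellation properties of thin triangles -/

/-- The fillers below are known only through some of their faces. This lemma and the next two read
lower faces off those, leaving a check on vertices that `decide` performs. -/
theorem face_eq {X : SSet.{u}} {n m k : ℕ} {x : X _⦋n⦌} {v : Fin (m + 1) → Fin (n + 1)} {hv}
    {y : X _⦋m⦌} (h : sub x v hv = y) (w : Fin (k + 1) → Fin (m + 1))
    {u : Fin (k + 1) → Fin (n + 1)} {hu}
    (hw : ∀ i j, i ≤ j → w i ≤ w j := by decide)
    (e : ∀ i, v (w i) = u i := by decide) : sub x u hu = sub y w hw := by
  rw [← h, sub_sub_eq x e]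

theorem sub_sub_eq_sub_sub {X : SSet.{u}} {n m k l : ℕ} (x : X _⦋n⦌)
    {v : Fin (m + 1) → Fin (n + 1)} {hv} {w : Fin (k + 1) → Fin (m + 1)} {hw}
    {v' : Fin (l + 1) → Fin (n + 1)} {hv'} {w' : Fin (k + 1) → Fin (l + 1)} {hw'}
    (e : ∀ i, v (w i) = v' (w' i) := by decide) :
    sub (sub x v hv) w hw = sub (sub x v' hv') w' hw' := by
  rw [sub_sub x, sub_sub x]
  exact sub_congr x (funext e)

theorem sub_face_eq {X : SSet.{u}} {n m k l : ℕ} {x : X _⦋n⦌} {v : Fin (m + 1) → Fin (n + 1)}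
    {hv} {y : X _⦋m⦌} (h : sub x v hv = y) (w : Fin (k + 1) → Fin (m + 1))
    {v' : Fin (l + 1) → Fin (n + 1)} {hv'} {w' : Fin (k + 1) → Fin (l + 1)} {hw'}
    (hw : ∀ i j, i ≤ j → w i ≤ w j := by decide)
    (e : ∀ i, v (w i) = v' (w' i) := by decide) : sub (sub x v' hv') w' hw' = sub y w hw := by
  rw [sub_sub x]
  exact face_eq h w hw e

/-- If the first edge of a tetrahedron has a section up to a thin triangle, then the face
opposite to the first vertex is thin as soon as the three other faces are. -/
theorem IsInfBicategory.thin_123 (hE : E.IsInfBicategory) (t : E.toSSet _⦋3⦌)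
    (s : E.toSSet _⦋2⦌) (hs : s ∈ E.thin) (hs12 : sub s ![1, 2] = sub t ![0, 1])
    (hs02 : sub s ![0, 2] = sub t ![1, 1])
    (h012 : sub t ![0, 1, 2] ∈ E.thin) (h013 : sub t ![0, 1, 3] ∈ E.thin)
    (h023 : sub t ![0, 2, 3] ∈ E.thin) : sub t ![1, 2, 3] ∈ E.thin := by
  -- Write 1' for the initial vertex of `s`, a copy of the vertex 1 of `t`. The tetrahedra `A` and
  -- `B` have vertices 1'012 and 1'013, with `s` as first face and degenerate face 1'12,
  -- respectively 1'13.
  obtain ⟨A, hA0, hA1, hA3⟩ := hE.fill₃₂ (sub t ![0, 1, 2]) (sub t ![1, 1, 2]) s h012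
    ((sub_sub_eq t).trans hs12.symm) (sub_sub_eq_sub_sub t)
    ((sub_sub_eq t).trans hs02.symm)
  obtain ⟨B, hB0, hB1, hB3⟩ := hE.fill₃₂ (sub t ![0, 1, 3]) (sub t ![1, 1, 3]) s h013
    ((sub_sub_eq t).trans hs12.symm) (sub_sub_eq_sub_sub t)
    ((sub_sub_eq t).trans hs02.symm)
  have hA : sub A ![0, 1, 3] ∈ E.thin :=
    hE.thin_013 A (thin_of_eq hs hA3.symm)
      (thin_of_eq (E.sub_thin_of_degenerate t) hA1.symm) (thin_of_eq h012 hA0.symm)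
  have hB : sub B ![0, 1, 3] ∈ E.thin :=
    hE.thin_013 B (thin_of_eq hs hB3.symm)
      (thin_of_eq (E.sub_thin_of_degenerate t) hB1.symm) (thin_of_eq h013 hB0.symm)
  obtain ⟨T, hT0, hT1, hT3, hT4⟩ := hE.fill₄₂ t (sub t ![1, 1, 2, 3]) B A
    (thin_of_eq h012 hA0.symm) (sub_sub_eq t).symm hB0.symm hA0.symm
    ((sub_sub_eq t).trans hB1.symm) ((sub_sub_eq t).trans hA1.symm) (hB3.trans hA3.symm)
  -- `T` has vertices 1'0123. In its face 1'023 the triangles 1'02, 1'03 and 023 are thin, hence so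
  -- is 1'23, which equals the face 123 of `t`.
  have h := hE.thin_023 (sub T ![0, 1, 3, 4])
    (thin_of_eq hA (sub_face_eq hT4 ![0, 1, 3]).symm)
    (thin_of_eq hB (sub_face_eq hT3 ![0, 1, 3]).symm)
    (thin_of_eq h023 (sub_face_eq hT0 ![0, 2, 3]).symm)
  exact thin_of_eq h (((sub_face_eq hT1 ![0, 2, 3]).trans (sub_sub_eq t)))

/-- A variant of the saturation property, in which the triangle `Δ^{2,3,4}` takes the place of
the triangle `Δ^{0,1,2}`. -/
theorem IsInfBicategory.saturation' (hE : E.IsInfBicategory) (t : E.toSSet _⦋4⦌)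
    (h024 : sub t ![0, 2, 4] ∈ E.thin) (h123 : sub t ![1, 2, 3] ∈ E.thin)
    (h013 : sub t ![0, 1, 3] ∈ E.thin) (h134 : sub t ![1, 3, 4] ∈ E.thin)
    (h234 : sub t ![2, 3, 4] ∈ E.thin) : sub t ![0, 3, 4] ∈ E.thin := by
  have h124 : sub t ![1, 2, 4] ∈ E.thin :=
    thin_of_eq (hE.thin_013 (sub t ![1, 2, 3, 4]) (thin_of_eq h123 (sub_sub_eq t).symm)
      (thin_of_eq h134 (sub_sub_eq t).symm) (thin_of_eq h234 (sub_sub_eq t).symm)) (sub_sub_eq t)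
  -- The thin triangles `p` and `q` choose composites of 03, 34 and of 02, 24. Consider three
  -- 2-cells: from 04 to the composite of `p` (the face 013 of `A`), from there to the composite of
  -- `q` (that of `C`), and from there to the composite of 01, 14 (that of `D`). The first two
  -- compose to the face 023 of `F`, the last two to the face 013 of `J`. Both are thin, so
  -- two-out-of-six makes the first cell thin, which is equivalent to what is wanted for 034.
  obtain ⟨p, hp, hp0, hp1⟩ := hE.fill₂ (sub t ![0, 3]) (sub t ![3, 4])
    (sub_sub_eq_sub_sub t)
  obtain ⟨q, hq, hq0, hq1⟩ := hE.fill₂ (sub t ![0, 2]) (sub t ![2, 4])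
    (sub_sub_eq_sub_sub t)
  obtain ⟨A, hA0, hA1, hA3⟩ := hE.fill₃₂ p (sub t ![0, 3, 4]) (sub t ![0, 0, 3]) hp
    (hp0.trans (sub_sub_eq t).symm) (hp1.trans (sub_sub_eq t).symm)
    (sub_sub_eq_sub_sub t)
  obtain ⟨B, hB0, hB1, hB3⟩ := hE.fill₃₂ (sub t ![2, 3, 4]) p (sub t ![0, 2, 3]) h234
    (sub_sub_eq_sub_sub t)
    ((sub_sub_eq t).trans hp1.symm) (hp0.trans (sub_sub_eq t).symm)
  have hB02 : sub B ![0, 1] = sub t ![0, 2] := (face_eq hB3 ![0, 1]).trans (sub_sub_eq t)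
  have hB24 : sub B ![1, 3] = sub t ![2, 4] := (face_eq hB0 ![0, 2]).trans (sub_sub_eq t)
  obtain ⟨C, hC0, hC1, hC3⟩ := hE.fill₃₂ q (sub B ![0, 1, 3]) (sub t ![0, 0, 2]) hq
    (hq0.trans (sub_sub_eq t).symm)
    (hq1.trans (hB24.symm.trans (sub_sub_eq B).symm))
    ((sub_sub_eq B).trans (hB02.trans (sub_sub_eq t).symm))
  obtain ⟨D, hD0, hD1, hD3⟩ := hE.fill₃₂ (sub t ![1, 2, 4]) q (sub t ![0, 1, 2]) h124
    (sub_sub_eq_sub_sub t)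
    ((sub_sub_eq t).trans hq1.symm) (hq0.trans (sub_sub_eq t).symm)
  obtain ⟨F, hF0, hF2, hF3⟩ := hE.fill₃₁ (sub C ![0, 1, 3]) (sub A ![0, 1, 3])
    (sub t ![0, 0, 0]) (E.sub_thin_of_degenerate t)
    (((sub_face_eq hC3 ![0, 1]).trans
      (sub_sub_eq_sub_sub t)))
    ((sub_face_eq hC1 ![0, 2]).trans
      ((sub_face_eq hB1 ![0, 2]).trans (sub_face_eq hA0 ![0, 2]).symm))
    (((sub_face_eq hA3 ![0, 1]).trans
      (sub_sub_eq_sub_sub t)))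
  obtain ⟨J, hJ0, hJ1, hJ3⟩ := hE.fill₃₂ (sub t ![1, 3, 4]) p (sub t ![0, 1, 3]) h134
    (sub_sub_eq_sub_sub t)
    ((sub_sub_eq t).trans hp1.symm) (hp0.trans (sub_sub_eq t).symm)
  have hJ : sub J ![0, 1, 3] ∈ E.thin := hE.thin_013 J (thin_of_eq h013 hJ3.symm)
    (thin_of_eq hp hJ1.symm) (thin_of_eq h134 hJ0.symm)
  obtain ⟨P, hP0, hP2, hP3⟩ := hE.fill₃₁ (sub J ![0, 1, 3]) (sub A ![0, 1, 3])
    (sub t ![0, 0, 1]) (E.sub_thin_of_degenerate t)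
    (((sub_face_eq hJ3 ![0, 1]).trans
      (sub_sub_eq_sub_sub t)))
    (((sub_face_eq hJ1 ![0, 2]).trans (sub_face_eq hA0 ![0, 2]).symm))
    (((sub_face_eq hA3 ![0, 1]).trans
      (sub_sub_eq_sub_sub t)))
  obtain ⟨T₁, h₁0, h₁1, h₁2, h₁4⟩ := hE.fill₄₃ B (sub t ![0, 2, 3, 4]) A
    (sub t ![0, 0, 2, 3]) (thin_of_eq h234 hB0.symm)
    (hB0.trans (sub_sub_eq t).symm) (hB1.trans hA0.symm) (hB3.trans (sub_sub_eq t).symm)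
    ((sub_sub_eq t).trans hA1.symm) (sub_sub_eq_sub_sub t)
    (hA3.trans (sub_sub_eq t).symm)
  obtain ⟨T₂, h₂0, h₂2, h₂3, h₂4⟩ := hE.fill₄₁ C (sub T₁ ![0, 1, 2, 4]) F
    (sub t ![0, 0, 0, 2]) (by rw [sub_sub]; exact E.sub_thin_of_degenerate t)
    (hC1.trans (sub_face_eq h₁0 ![0, 1, 3]).symm) hF0.symm
    (hC3.trans (sub_sub_eq t).symm)
    (((sub_face_eq h₁2 ![0, 1, 3]).trans hF2.symm))
    (((sub_face_eq h₁4 ![0, 1, 2]).trans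
      (sub_sub_eq_sub_sub t)))
    (hF3.trans (sub_sub_eq t).symm)
  -- The composite of the first two cells compares 04 with the composite of `q`; it is thin because
  -- 024 and `q` are. `T₁` and `T₂` supply the coherence.
  have hF : sub F ![0, 2, 3] ∈ E.thin := by
    have h := hE.thin_013 (sub T₂ ![0, 2, 3, 4])
      (thin_of_eq (E.sub_thin_of_degenerate t)
        ((sub_sub_eq t (u := ![0, 0, 2]) (hu := by decide)).symm.trans
        (sub_face_eq h₂4 ![0, 2, 3]).symm))
      (thin_of_eq h024 ((sub_sub_eq t (u := ![0, 2, 4]) (hu := by decide)).symm.trans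
        ((sub_face_eq h₁1 ![0, 1, 3]).symm.trans (sub_face_eq h₂2 ![0, 2, 3]).symm)))
      (thin_of_eq hq (hC0.symm.trans (sub_face_eq h₂0 ![1, 2, 3]).symm))
    exact thin_of_eq h (sub_face_eq h₂3 ![0, 2, 3])
  obtain ⟨T₃, h₃0, h₃1, h₃2, h₃4⟩ := hE.fill₄₃ (sub t ![1, 2, 3, 4]) B J
    (sub t ![0, 1, 2, 3]) (thin_of_eq h234 (sub_sub_eq t).symm)
    ((sub_sub_eq t).trans hB0.symm) ((sub_sub_eq t).trans hJ0.symm)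
    (sub_sub_eq_sub_sub t)
    (hB1.trans hJ1.symm) (hB3.trans (sub_sub_eq t).symm) (hJ3.trans (sub_sub_eq t).symm)
  obtain ⟨T₄, h₄0, h₄1, h₄2, h₄4⟩ := hE.fill₄₃ D (sub T₃ ![0, 1, 2, 4]) C
    (sub t ![0, 0, 1, 2]) (thin_of_eq h124 hD0.symm)
    (hD0.trans ((sub_sub_eq t).symm.trans (sub_face_eq h₃0 ![0, 1, 3]).symm))
    (hD1.trans hC0.symm) (hD3.trans (sub_sub_eq t).symm)
    (((sub_face_eq h₃1 ![0, 1, 3]).trans hC1.symm))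
    (((sub_face_eq h₃4 ![0, 1, 2]).trans
      (sub_sub_eq_sub_sub t)))
    (hC3.trans (sub_sub_eq t).symm)
  obtain ⟨T₅, h₅0, h₅2, h₅3, h₅4⟩ := hE.fill₄₁ (sub T₄ ![0, 1, 2, 4]) P F
    (sub t ![0, 0, 0, 1]) (by rw [sub_sub]; exact E.sub_thin_of_degenerate t)
    (((sub_face_eq h₄1 ![0, 1, 3]).trans (((sub_face_eq h₃2 ![0, 1, 3]).trans hP0.symm))))
    (((sub_face_eq h₄2 ![0, 1, 3]).trans hF0.symm))
    (((sub_face_eq h₄4 ![0, 1, 2]).trans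
      (sub_sub_eq_sub_sub t)))
    (hP2.trans hF2.symm) (hP3.trans (sub_sub_eq t).symm) (hF3.trans (sub_sub_eq t).symm)
  -- `T₅` lies over the vertices 0, 0, 0, 1, 4. The edges from its first three vertices to the last
  -- are 04 and the composites of `p` and `q`. Its triangles 024 and 134 are the two composite
  -- cells, and its triangle 014 is the first cell.
  have h := (hE.saturation T₅ (thin_of_eq hF (face_eq h₅3 ![0, 2, 3]).symm)
    (thin_of_eq (E.sub_thin_of_degenerate t)
        ((sub_sub_eq t (u := ![0, 0, 1]) (hu := by decide)).symm.trans
      (face_eq h₅4 ![1, 2, 3]).symm))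
    (thin_of_eq (E.sub_thin_of_degenerate t)
        ((sub_sub_eq t (u := ![0, 0, 1]) (hu := by decide)).symm.trans
      (face_eq h₅4 ![0, 1, 3]).symm))
    (thin_of_eq hJ (hP0.symm.trans (face_eq h₅2 ![1, 2, 3]).symm))
    (thin_of_eq (E.sub_thin_of_degenerate t)
        ((sub_sub_eq t (u := ![0, 0, 0]) (hu := by decide)).symm.trans
      (face_eq h₅4 ![0, 1, 2]).symm))).2
  refine thin_of_eq (hE.thin_023 A (thin_of_eq (E.sub_thin_of_degenerate t) hA3.symm)
    (thin_of_eq h ((face_eq h₅3 ![0, 1, 3]).trans hF2)) (thin_of_eq hp hA0.symm)) hA1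

end ScaledSSet

/-! ## Invertible edges -/

namespace SSet.Truncated

/-- The comparison functor from the homotopy category to the category of homotopy classes of
edges, for a `2`-truncated quasicategory. -/
noncomputable def toHomotopyCategory₂ (V : Truncated.{u} 2) [Quasicategory₂ V] :
    V.HomotopyCategory ⥤ HomotopyCategory₂ V :=
  HomotopyCategory.lift HomotopyCategory₂.mk (fun e => HomotopyCategory₂.homMk e)
    (fun x => HomotopyCategory₂.homMk_id ⟨x⟩) (fun s => s.homotopyCategory₂_fac)

/-- In `HomotopyCategory₂` every morphism is the class of a single edge, and an equality of
composites is witnessed by a triangle. Carrying the isomorphism there turns its inverse into an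
actual edge. -/
theorem exists_inverse_of_isIso {V : Truncated.{u} 2} [Quasicategory₂ V]
    {x y : V.obj (op ⟨⦋0⦌, by simp⟩)} (e : Edge x y)
    (he : IsIso (HomotopyCategory.homMk e)) :
    ∃ e' : Edge y x, Nonempty (Edge.CompStruct e e' (Edge.id x)) ∧
      Nonempty (Edge.CompStruct e' e (Edge.id y)) := by
  have h : IsIso (HomotopyCategory₂.homMk e) := by
    have := Functor.map_isIso (toHomotopyCategory₂ V) (HomotopyCategory.homMk e)
    have h2 : (toHomotopyCategory₂ V).map (HomotopyCategory.homMk e) =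
      HomotopyCategory₂.homMk e := HomotopyCategory.lift_map_homMk _ _ _ _ e
    exact h2 ▸ this
  obtain ⟨e', he'⟩ := HomotopyCategory₂.homMk_surjective (inv (HomotopyCategory₂.homMk e))
  refine ⟨e', Edge.CompStruct.nonempty_iff.2 ?_, Edge.CompStruct.nonempty_iff.2 ?_⟩
  · rw [he']
    exact IsIso.hom_inv_id _
  · rw [he']
    exact IsIso.inv_hom_id _

end SSet.Truncated

namespace ScaledSSet

open SSet

/-- A monotone self-map of `{0, 1, 2}` is the identity or identifies two consecutive vertices. -/
theorem sub_thin_of_thin (X : ScaledSSet.{u}) {x : X.toSSet _⦋2⦌} (hx : x ∈ X.thin)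
    (v : Fin 3 → Fin 3) (hv) : sub x v hv ∈ X.thin := by
  by_cases h : v 0 = v 1 ∨ v 1 = v 2
  · exact X.sub_thin_of_degenerate x h
  · have h01 := hv 0 1 (by decide)
    have h12 := hv 1 2 (by decide)
    have key : ∀ a b c : Fin 3, ¬(a = b ∨ b = c) → a ≤ b → b ≤ c → a = 0 ∧ b = 1 ∧ c = 2 := by
      decide
    obtain ⟨h0, h1, h2⟩ := key _ _ _ h h01 h12
    refine thin_of_eq hx (sub_self x ?_).symm
    intro i
    fin_cases i
    exacts [h0, h1, h2]

theorem sub_thin_of_faces (X : ScaledSSet.{u}) {x : X.toSSet _⦋3⦌}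
    (h012 : sub x ![0, 1, 2] ∈ X.thin) (h013 : sub x ![0, 1, 3] ∈ X.thin)
    (h023 : sub x ![0, 2, 3] ∈ X.thin) (h123 : sub x ![1, 2, 3] ∈ X.thin)
    (v : Fin 3 → Fin 4) (hv) : sub x v hv ∈ X.thin := by
  by_cases h : v 0 = v 1 ∨ v 1 = v 2
  · exact X.sub_thin_of_degenerate x h
  · have key : ∀ a b c : Fin 4, ¬(a = b ∨ b = c) → a ≤ b → b ≤ c →
        (a = 0 ∧ b = 1 ∧ c = 2) ∨ (a = 0 ∧ b = 1 ∧ c = 3) ∨ (a = 0 ∧ b = 2 ∧ c = 3) ∨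
          (a = 1 ∧ b = 2 ∧ c = 3) := by
      decide
    rcases key _ _ _ h (hv 0 1 (by decide)) (hv 1 2 (by decide)) with
      ⟨h0, h1, h2⟩ | ⟨h0, h1, h2⟩ | ⟨h0, h1, h2⟩ | ⟨h0, h1, h2⟩
    exacts [thin_of_three_vertices h012 h0 h1 h2, thin_of_three_vertices h013 h0 h1 h2,
      thin_of_three_vertices h023 h0 h1 h2, thin_of_three_vertices h123 h0 h1 h2]

theorem mem_core_iff_thin (X : ScaledSSet.{u}) (x : X.toSSet _⦋2⦌) :
    x ∈ X.core.obj (op ⦋2⦌) ↔ x ∈ X.thin := by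
  refine ⟨fun h => ?_, fun h g => ?_⟩
  · exact thin_of_eq (h (𝟙 _)) ((map_eq_sub x (𝟙 _)).trans (sub_self x (fun _ => rfl)))
  · exact thin_of_eq (X.sub_thin_of_thin h _ _) (map_eq_sub x g).symm

/-- The `2`-truncation of the core. -/
abbrev coreTruncation (C : ScaledSSet.{u}) : SSet.Truncated.{u} 2 :=
  (truncation 2).obj (C.core : SSet.{u})

section

variable {C : ScaledSSet.{u}} {x y z : C.coreTruncation.obj (op ⟨⦋0⦌, by simp⟩)}
  {a : Truncated.Edge x y} {b : Truncated.Edge y z} {c : Truncated.Edge x z}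

theorem nonempty_compStruct (t : C.toSSet _⦋2⦌) (ht : t ∈ C.thin)
    (ha : sub t ![0, 1] = a.edge.1) (hb : sub t ![1, 2] = b.edge.1)
    (hc : sub t ![0, 2] = c.edge.1) : Nonempty (Truncated.Edge.CompStruct a b c) :=
  ⟨{ simplex := ⟨t, (C.mem_core_iff_thin t).2 ht⟩
     d₂ := Subtype.ext ((δ_eq_sub t 2).trans ha)
     d₀ := Subtype.ext ((δ_eq_sub t 0).trans hb)
     d₁ := Subtype.ext ((δ_eq_sub t 1).trans hc) }⟩

theorem exists_of_compStruct (s : Truncated.Edge.CompStruct a b c) :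
    ∃ t ∈ C.thin, sub t ![0, 1] = a.edge.1 ∧ sub t ![1, 2] = b.edge.1 ∧
      sub t ![0, 2] = c.edge.1 :=
  ⟨s.simplex.1, (C.mem_core_iff_thin _).1 s.simplex.2,
    (δ_eq_sub _ 2).symm.trans (congrArg Subtype.val s.d₂),
    (δ_eq_sub _ 0).symm.trans (congrArg Subtype.val s.d₀),
    (δ_eq_sub _ 1).symm.trans (congrArg Subtype.val s.d₁)⟩

end

theorem sub_zero_edge {C : ScaledSSet.{u}} {x y : C.coreTruncation.obj (op ⟨⦋0⦌, by simp⟩)}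
    (a : Truncated.Edge x y) : sub a.edge.1 ![0] = x.1 :=
  (δ_eq_sub a.edge.1 1).symm.trans (congrArg Subtype.val a.src_eq)

theorem sub_one_edge {C : ScaledSSet.{u}} {x y : C.coreTruncation.obj (op ⟨⦋0⦌, by simp⟩)}
    (a : Truncated.Edge x y) : sub a.edge.1 ![1] = y.1 :=
  (δ_eq_sub a.edge.1 0).symm.trans (congrArg Subtype.val a.tgt_eq)

/-- Inner horns of dimension 2 have thin fillers. For a three-dimensional inner horn with thin
faces, the filler exists in `C`, and its new face is thin by `thin_023` or `thin_013`, hence lies in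
the core. -/
instance IsInfBicategory.quasicategory₂_core {C : ScaledSSet.{u}} [hC : Fact C.IsInfBicategory] :
    Truncated.Quasicategory₂ C.coreTruncation where
  fill21 {x₀ x₁ x₂} a b := by
    obtain ⟨t, ht, h1, h2⟩ := hC.out.fill₂ a.edge.1 b.edge.1
      ((sub_one_edge a).trans (sub_zero_edge b).symm)
    let c : Truncated.Edge x₀ x₂ :=
      { edge := ⟨sub t ![0, 2], C.edge_mem_core _⟩
        src_eq := Subtype.ext
          ((δ_eq_sub _ 1 (v := ![0]) (hv := by decide)).trans ((sub_sub_eq_sub_sub t).trans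
          ((congrArg (fun e => sub e ![0]) h1).trans (sub_zero_edge a))))
        tgt_eq := Subtype.ext
          ((δ_eq_sub _ 0 (v := ![1]) (hv := by decide)).trans ((sub_sub_eq_sub_sub t).trans
          ((congrArg (fun e => sub e ![1]) h2).trans (sub_one_edge b)))) }
    exact ⟨c, (nonempty_compStruct t ht h1 h2 rfl).some⟩
  fill31 f₃ f₀ f₂ := by
    obtain ⟨t₃, h₃, h₃a, h₃b, h₃c⟩ := exists_of_compStruct f₃
    obtain ⟨t₀, h₀, h₀a, h₀b, h₀c⟩ := exists_of_compStruct f₀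
    obtain ⟨t₂, h₂, h₂a, h₂b, h₂c⟩ := exists_of_compStruct f₂
    obtain ⟨T, hT0, hT2, hT3⟩ := hC.out.fill₃₁ t₀ t₂ t₃ h₃ (h₀a.trans h₃b.symm)
      (h₀c.trans h₂b.symm) (h₂a.trans h₃a.symm)
    exact nonempty_compStruct (sub T ![0, 2, 3])
      (hC.out.thin_023 T (thin_of_eq h₃ hT3.symm) (thin_of_eq h₂ hT2.symm)
        (thin_of_eq h₀ hT0.symm))
      ((sub_face_eq hT3 ![0, 2]).trans h₃c) ((sub_face_eq hT0 ![1, 2]).trans h₀b)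
      ((sub_face_eq hT2 ![0, 2]).trans h₂c)
  fill32 f₃ f₀ f₁ := by
    obtain ⟨t₃, h₃, h₃a, h₃b, h₃c⟩ := exists_of_compStruct f₃
    obtain ⟨t₀, h₀, h₀a, h₀b, h₀c⟩ := exists_of_compStruct f₀
    obtain ⟨t₁, h₁, h₁a, h₁b, h₁c⟩ := exists_of_compStruct f₁
    obtain ⟨T, hT0, hT1, hT3⟩ := hC.out.fill₃₂ t₀ t₁ t₃ h₀ (h₀a.trans h₃b.symm)
      (h₀b.trans h₁b.symm) (h₁a.trans h₃c.symm)
    exact nonempty_compStruct (sub T ![0, 1, 3])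
      (hC.out.thin_013 T (thin_of_eq h₃ hT3.symm) (thin_of_eq h₁ hT1.symm)
        (thin_of_eq h₀ hT0.symm))
      ((sub_face_eq hT3 ![0, 1]).trans h₃a) ((sub_face_eq hT0 ![0, 2]).trans h₀c)
      ((sub_face_eq hT1 ![0, 2]).trans h₁c)

/-- An invertible edge of an ∞-bicategory has an inverse up to thin triangles. -/
theorem IsInfBicategory.exists_inverse {C : ScaledSSet.{u}} (hC : C.IsInfBicategory)
    {e : C.toSSet _⦋1⦌} (he : C.IsInvertible e) :
    ∃ s ∈ C.thin, ∃ t ∈ C.thin, sub s ![0, 1] = e ∧ sub s ![0, 2] = sub e ![0, 0] ∧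
      sub t ![1, 2] = e ∧ sub t ![0, 2] = sub e ![1, 1] ∧ sub s ![1, 2] = sub t ![0, 1] := by
  have : Fact C.IsInfBicategory := ⟨hC⟩
  obtain ⟨e', ⟨s⟩, ⟨t⟩⟩ := Truncated.exists_inverse_of_isIso _ he
  obtain ⟨s, hs, hs1, hs2, hs3⟩ := exists_of_compStruct s
  obtain ⟨t, ht, ht1, ht2, ht3⟩ := exists_of_compStruct t
  refine ⟨s, hs, t, ht, hs1, hs3.trans ?_, ht2, ht3.trans ?_, hs2.trans ht1.symm⟩
  · exact (σ_eq_sub (C.toSSet.δ 1 e) 0 (v := ![0, 0]) (hv := by decide)).trans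
      ((congrArg (fun k => sub k ![0, 0]) (δ_eq_sub e 1 (v := ![0]) (hv := by decide))).trans
        (sub_sub_eq e))
  · exact (σ_eq_sub (C.toSSet.δ 0 e) 0 (v := ![0, 0]) (hv := by decide)).trans
      ((congrArg (fun k => sub k ![0, 0]) (δ_eq_sub e 0 (v := ![1]) (hv := by decide))).trans
        (sub_sub_eq e))

/-- For an invertible edge `e` of an ∞-bicategory, there is a tetrahedron all of whose faces
are thin, which has `e` as its first and third successive edges, and which exhibits its second
successive edge as inverse to `e`. -/
theorem IsInfBicategory.exists_tetrahedron {C : ScaledSSet.{u}} (hC : C.IsInfBicategory)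
    {e : C.toSSet _⦋1⦌} (he : C.IsInvertible e) :
    ∃ T : C.toSSet _⦋3⦌, (∀ (v : Fin 3 → Fin 4) (hv), sub T v hv ∈ C.thin) ∧
      sub T ![0, 2] = sub T ![0, 0] ∧ sub T ![1, 3] = sub T ![3, 3] ∧ sub T ![0, 3] = e ∧
      sub T ![0, 2, 3] = sub e ![0, 0, 1] := by
  -- With `e : x ⟶ y`, the tetrahedron has vertices x, y, x, y: the two witnesses of invertibility
  -- are its faces 012 and 123, and 023 is degenerate.
  obtain ⟨s, hs, t, ht, hs1, hs2, ht1, ht2, hst⟩ := hC.exists_inverse he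
  obtain ⟨T, hT0, hT1, hT3⟩ := hC.fill₃₂ t (sub e ![0, 0, 1]) s ht hst.symm
    (ht1.trans ((sub_self e (v := ![0, 1]) (hv := by decide)).symm.trans
      (sub_sub_eq e).symm)) ((sub_sub_eq e).trans hs2.symm)
  have h2 : sub T ![0, 1, 3] ∈ C.thin :=
    hC.thin_013 T (thin_of_eq hs hT3.symm) (thin_of_eq (C.sub_thin_of_degenerate e) hT1.symm)
      (thin_of_eq ht hT0.symm)
  have h03 : sub T ![0, 3] = e := (face_eq hT1 ![0, 2]).trans ((sub_sub_eq e (u := ![0, 1])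
    (hu := by decide)).trans (sub_self e))
  refine ⟨T, fun v hv => ?_, ?_, ?_, h03, hT1⟩
  · exact C.sub_thin_of_faces (thin_of_eq hs hT3.symm) h2
      (thin_of_eq (C.sub_thin_of_degenerate e) hT1.symm) (thin_of_eq ht hT0.symm) v hv
  · exact (face_eq hT3 ![0, 2]).trans (hs2.trans (face_eq h03 ![0, 0]).symm)
  · exact (face_eq hT0 ![0, 2]).trans (ht2.trans (face_eq h03 ![1, 1]).symm)

/-! ## Maps out of the Gray product and the scaling `T_≃` -/

section

variable {C D E : ScaledSSet.{u}}

theorem degeneratesAlong12_sub {X : SSet.{u}} {n : ℕ} (x : X _⦋n⦌) {v : Fin 3 → Fin (n + 1)} {hv}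
    (h : v 1 = v 2 := by decide) : DegeneratesAlong12 (sub x v hv) := by
  refine ⟨sub_mem_degenerate x 1 h, ?_⟩
  rw [δ_eq_sub (sub x v hv) 0 (v := ![1, 2]) (hv := by decide), sub_sub]
  exact sub_mem_degenerate x 0 h

theorem degeneratesAlong01_sub {X : SSet.{u}} {n : ℕ} (x : X _⦋n⦌) {v : Fin 3 → Fin (n + 1)} {hv}
    (h : v 0 = v 1 := by decide) : DegeneratesAlong01 (sub x v hv) := by
  refine ⟨sub_mem_degenerate x 0 h, ?_⟩
  rw [δ_eq_sub (sub x v hv) 2 (v := ![0, 1]) (hv := by decide), sub_sub]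
  exact sub_mem_degenerate x 0 h

theorem app_pair_sub {X Y Z : SSet.{u}} (f : X ⊗ Y ⟶ Z) {n m : ℕ} (x : X _⦋n⦌) (y : Y _⦋n⦌)
    (v : Fin (m + 1) → Fin (n + 1)) (hv) :
    f.app (op ⦋m⦌) (sub x v hv, sub y v hv) = sub (f.app (op ⦋n⦌) (x, y)) v hv :=
  app_sub f (x, y) v hv

/-- The faces of a simplex in the image of a product of simplices. -/
theorem app_pair_sub_sub {X Y Z : SSet.{u}} (f : X ⊗ Y ⟶ Z) {n n' m k : ℕ} (x : X _⦋n⦌)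
    (y : Y _⦋n'⦌) {v : Fin (m + 1) → Fin (n + 1)} {hv} {w : Fin (m + 1) → Fin (n' + 1)} {hw}
    {i : Fin (k + 1) → Fin (m + 1)} {hi}
    {v' : Fin (k + 1) → Fin (n + 1)} {hv'} {w' : Fin (k + 1) → Fin (n' + 1)} {hw'}
    (e : ∀ j, v (i j) = v' j := by decide) (e' : ∀ j, w (i j) = w' j := by decide) :
    f.app (op ⦋k⦌) (sub x v' hv', sub y w' hw') =
      sub (f.app (op ⦋m⦌) (sub x v hv, sub y w hw)) i hi := by
  rw [← app_pair_sub, sub_sub_eq x e, sub_sub_eq y e']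

theorem gray_thin {T : C.toSSet _⦋2⦌} {U : D.toSSet _⦋2⦌} (g : gray C D ⟶ E)
    (hT : T ∈ C.thin) (hU : U ∈ D.thin) (h : DegeneratesAlong12 T ∨ DegeneratesAlong01 U) :
    g.hom.app (op ⦋2⦌) (T, U) ∈ E.thin :=
  g.isScaledMap (T, U) ⟨⟨hT, hU⟩, h⟩

/-- This is the triangle along `e` first and `h` second, the order not made thin by the Gray
product. In the 4-simplex `(00001, 01233)` over `h` and the tetrahedron of `e`, the hypotheses of
saturation hold because the edges 02 and 13 of that tetrahedron are degenerate. The triangle 034 is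
the desired one. -/
theorem gray_thin_of_invertible_right (hD : D.IsInfBicategory) (hE : E.IsInfBicategory)
    (g : gray C D ⟶ E) (h : C.toSSet _⦋1⦌) {e : D.toSSet _⦋1⦌} (he : D.IsInvertible e) :
    g.hom.app (op ⦋2⦌) (sub h ![0, 0, 1], sub e ![0, 1, 1]) ∈ E.thin := by
  obtain ⟨T, hT, h02, h13, h03, h023⟩ := hD.exists_tetrahedron he
  have h133 : sub T ![1, 3, 3] = sub T ![3, 3, 3] :=
    (face_eq h13 ![0, 1, 1]).trans (sub_sub_eq T)
  have h' := (hE.saturation (g.hom.app (op ⦋4⦌) (sub h ![0, 0, 0, 0, 1], sub T ![0, 1, 2, 3, 3]))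
    (thin_of_eq (gray_thin g (T := sub h ![0, 0, 1]) (U := sub T ![0, 2, 3])
      (C.sub_thin_of_degenerate h) (hT _ _) (Or.inr (h023 ▸ degeneratesAlong01_sub e)))
        (app_pair_sub_sub g.hom h T))
    (thin_of_eq (gray_thin g (T := sub h ![0, 0, 0]) (U := sub T ![1, 2, 3])
      (C.sub_thin_of_degenerate h) (hT _ _) (Or.inl (degeneratesAlong12_sub h)))
        (app_pair_sub_sub g.hom h T))
    (thin_of_eq (gray_thin g (T := sub h ![0, 0, 0]) (U := sub T ![0, 1, 3])
      (C.sub_thin_of_degenerate h) (hT _ _) (Or.inl (degeneratesAlong12_sub h)))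
        (app_pair_sub_sub g.hom h T))
    (thin_of_eq (gray_thin g (T := sub h ![0, 0, 1]) (U := sub T ![1, 3, 3])
      (C.sub_thin_of_degenerate h) (hT _ _) (Or.inr (h133.symm ▸
        degeneratesAlong01_sub T (v := ![3, 3, 3]) (hv := by decide))))
        (app_pair_sub_sub g.hom h T))
    (thin_of_eq (gray_thin g (T := sub h ![0, 0, 0]) (U := sub T ![0, 1, 2])
      (C.sub_thin_of_degenerate h) (hT _ _) (Or.inl (degeneratesAlong12_sub h)))
        (app_pair_sub_sub g.hom h T))).1
  rw [← face_eq h03 ![0, 1, 1] (u := ![0, 3, 3]) (hu := by decide)]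
  exact thin_of_eq h' (app_pair_sub_sub g.hom h T).symm

/-- The same triangle, now with the edge of `C` invertible. The Gray scaling is not symmetric, so
this case needs the mirror form of saturation. -/
theorem gray_thin_of_invertible_left (hC : C.IsInfBicategory) (hE : E.IsInfBicategory)
    (g : gray C D ⟶ E) {h : C.toSSet _⦋1⦌} (hh : C.IsInvertible h) (e : D.toSSet _⦋1⦌) :
    g.hom.app (op ⦋2⦌) (sub h ![0, 0, 1], sub e ![0, 1, 1]) ∈ E.thin := by
  obtain ⟨T, hT, h02, h13, h03, h023⟩ := hC.exists_tetrahedron hh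
  have h113 : sub T ![1, 1, 3] = sub T ![3, 3, 3] :=
    (face_eq h13 ![0, 0, 1]).trans (sub_sub_eq T)
  have h002 : sub T ![0, 0, 2] = sub T ![0, 0, 0] :=
    (face_eq h02 ![0, 0, 1]).trans (sub_sub_eq T)
  -- The edge 13 of `T` is degenerate, so moving along it after `e` adds no interchange cell: the
  -- face `(113, 011)` is Gray-thin.
  have h013 : g.hom.app (op ⦋2⦌) (sub T ![0, 1, 3], sub e ![0, 1, 1]) ∈ E.thin :=
    thin_of_eq (hE.thin_023 (g.hom.app (op ⦋3⦌) (sub T ![0, 1, 1, 3], sub e ![0, 0, 1, 1]))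
      (thin_of_eq (gray_thin g (T := sub T ![0, 1, 1]) (U := sub e ![0, 0, 1])
        (hT _ _) (D.sub_thin_of_degenerate e) (Or.inl (degeneratesAlong12_sub T)))
          (app_pair_sub_sub g.hom T e))
      (thin_of_eq (gray_thin g (T := sub T ![0, 1, 3]) (U := sub e ![0, 0, 1])
        (hT _ _) (D.sub_thin_of_degenerate e) (Or.inr (degeneratesAlong01_sub e)))
          (app_pair_sub_sub g.hom T e))
      (thin_of_eq (gray_thin g (T := sub T ![1, 1, 3]) (U := sub e ![0, 1, 1])
        (hT _ _) (D.sub_thin_of_degenerate e) (Or.inl (h113.symm ▸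
          degeneratesAlong12_sub T (v := ![3, 3, 3]) (hv := by decide))))
          (app_pair_sub_sub g.hom T e))) (app_pair_sub_sub g.hom T e).symm
  -- By construction the edge 01 of `T` is `h`, so the triangle 012 of this 4-simplex is the very
  -- triangle sought and the original axiom would be circular. The triangle 234 used instead lies
  -- over a single vertex of `D`.
  have h' := hE.saturation'
    (g.hom.app (op ⦋4⦌) (sub T ![0, 0, 1, 2, 3], sub e ![0, 1, 1, 1, 1]))
    (thin_of_eq h013 (app_pair_sub_sub g.hom T e))
    (thin_of_eq (gray_thin g (T := sub T ![0, 1, 2]) (U := sub e ![1, 1, 1])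
      (hT _ _) (D.sub_thin_of_degenerate e) (Or.inr (degeneratesAlong01_sub e)))
        (app_pair_sub_sub g.hom T e))
    (thin_of_eq (gray_thin g (T := sub T ![0, 0, 2]) (U := sub e ![0, 1, 1])
      (hT _ _) (D.sub_thin_of_degenerate e) (Or.inl (h002.symm ▸
        degeneratesAlong12_sub T (v := ![0, 0, 0]) (hv := by decide))))
        (app_pair_sub_sub g.hom T e))
    (thin_of_eq (gray_thin g (T := sub T ![0, 2, 3]) (U := sub e ![1, 1, 1])
      (hT _ _) (D.sub_thin_of_degenerate e) (Or.inr (degeneratesAlong01_sub e)))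
        (app_pair_sub_sub g.hom T e))
    (thin_of_eq (gray_thin g (T := sub T ![1, 2, 3]) (U := sub e ![1, 1, 1])
      (hT _ _) (D.sub_thin_of_degenerate e) (Or.inr (degeneratesAlong01_sub e)))
        (app_pair_sub_sub g.hom T e))
  rw [← h023]
  exact thin_of_eq h' (app_pair_sub_sub g.hom T e).symm

theorem app_triple_sub_sub {W X Y Z : SSet.{u}} (f : W ⊗ (X ⊗ Y) ⟶ Z) {p n n' m k : ℕ}
    (t : W _⦋p⦌) (x : X _⦋n⦌) (y : Y _⦋n'⦌) {u : Fin (m + 1) → Fin (p + 1)} {hu}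
    {v : Fin (m + 1) → Fin (n + 1)} {hv} {w : Fin (m + 1) → Fin (n' + 1)} {hw}
    {i : Fin (k + 1) → Fin (m + 1)} {hi} {u' : Fin (k + 1) → Fin (p + 1)} {hu'}
    {v' : Fin (k + 1) → Fin (n + 1)} {hv'} {w' : Fin (k + 1) → Fin (n' + 1)} {hw'}
    (e₀ : ∀ j, u (i j) = u' j := by decide) (e : ∀ j, v (i j) = v' j := by decide)
    (e' : ∀ j, w (i j) = w' j := by decide) :
    f.app (op ⦋k⦌) (sub t u' hu', (sub x v' hv', sub y w' hw')) =
      sub (f.app (op ⦋m⦌) (sub t u hu, (sub x v hv, sub y w hw))) i hi := by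
  rw [← sub_sub_eq t e₀ (hw := hi), ← sub_sub_eq x e (hw := hi), ← sub_sub_eq y e' (hw := hi)]
  exact app_sub f (sub t u hu, (sub x v hv, sub y w hw)) i hi

/-- The restriction to `{k} × Y` of a map out of `K × Y`. -/
def fiberMap {K Y E : ScaledSSet.{u}} (f : prod K Y ⟶ E) (k : K.toSSet _⦋0⦌) : Y ⟶ E :=
  Hom.mk (lift (SSet.const k) (𝟙 Y.toSSet) ≫ f.hom) (fun σ hσ => f.isScaledMap _
    ⟨K.degenerate_subset ⟨0, by norm_num, SimplexCategory.const ⦋2⦌ ⦋0⦌ 0, k, rfl⟩, hσ⟩)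

theorem fiberMap_app {K Y E : ScaledSSet.{u}} (f : prod K Y ⟶ E) {n m : ℕ} (k : K.toSSet _⦋n⦌)
    (i : Fin (n + 1)) (y : Y.toSSet _⦋m⦌) :
    (fiberMap f (sub k (fun _ => i) (fun _ _ _ => le_rfl))).hom.app (op ⦋m⦌) y =
      f.hom.app (op ⦋m⦌) (sub k (fun _ => i) (fun _ _ _ => le_rfl), y) := by
  refine congrArg (fun x => f.hom.app (op ⦋m⦌) (x, y)) ?_
  exact (map_eq_sub _ _).trans (sub_sub_eq k (fun _ => rfl))

/-- A map out of `K × (C ⊗ D)` is a map out of the product of `K` with `(C × D, T_≃)`. -/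
theorem isScaledMap_prod_grayInv {K : ScaledSSet.{u}} (hC : C.IsInfBicategory)
    (hD : D.IsInfBicategory) (hE : E.IsInfBicategory) (f : prod K (gray C D) ⟶ E) :
    IsScaledMap (prod K (grayInv C D)) E f.hom := by
  rintro ⟨k, c, d⟩ ⟨hk, ⟨hc, hd⟩, hinv⟩
  have key : ∀ (T : K.toSSet _⦋2⦌) (U : C.toSSet _⦋2⦌) (V : D.toSSet _⦋2⦌), T ∈ K.thin →
      U ∈ C.thin → V ∈ D.thin → DegeneratesAlong12 U ∨ DegeneratesAlong01 V →
        f.hom.app (op ⦋2⦌) (T, (U, V)) ∈ E.thin :=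
    fun T U V hT hU hV h => f.isScaledMap (T, (U, V)) ⟨hT, ⟨hU, hV⟩, h⟩
  -- The only part not covered by the Gray scaling: the interchange triangle of the edge 12 of `c`
  -- and the edge 01 of `d`, over the vertex 1 of `k`. Invertibility enters only here.
  have hN : f.hom.app (op ⦋2⦌) (sub k ![1, 1, 1], (sub c ![1, 1, 2], sub d ![0, 1, 1])) ∈
      E.thin := by
    have h : (fiberMap f (sub k (fun _ => 1))).hom.app (op ⦋2⦌)
        (sub (sub c ![1, 2]) ![0, 0, 1], sub (sub d ![0, 1]) ![0, 1, 1]) ∈ E.thin := by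
      rcases hinv with h | h
      · exact gray_thin_of_invertible_left hC hE _
          (δ_eq_sub c 0 (v := ![1, 2]) (hv := by decide) ▸ h) _
      · exact gray_thin_of_invertible_right hD hE _ _
          (δ_eq_sub d 2 (v := ![0, 1]) (hv := by decide) ▸ h)
    rw [sub_sub_eq c (u := ![1, 1, 2]) (hu := by decide),
      sub_sub_eq d (u := ![0, 1, 1]) (hu := by decide)] at h
    refine thin_of_eq h ((fiberMap_app f k 1 _).trans ?_)
    exact congrArg (fun x => f.hom.app (op ⦋2⦌) (x, (sub c ![1, 1, 2], sub d ![0, 1, 1])))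
      (sub_congr k (w := ![1, 1, 1]) (by decide))
  -- In the tetrahedron `(0111, 0112, 0011)` the faces 012 and 013 are Gray-thin and 123 is `hN`.
  have h₁ : f.hom.app (op ⦋2⦌) (sub k ![0, 1, 1], (sub c ![0, 1, 2], sub d ![0, 1, 1])) ∈
      E.thin :=
    thin_of_eq (hE.thin_023 (f.hom.app (op ⦋3⦌)
        (sub k ![0, 1, 1, 1], (sub c ![0, 1, 1, 2], sub d ![0, 0, 1, 1])))
      (thin_of_eq (key (sub k ![0, 1, 1]) (sub c ![0, 1, 1]) (sub d ![0, 0, 1])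
        (K.sub_thin_of_thin hk _ _) (C.sub_thin_of_thin hc _ _) (D.sub_thin_of_thin hd _ _)
        (Or.inl (degeneratesAlong12_sub c))) (app_triple_sub_sub f.hom k c d))
      (thin_of_eq (key (sub k ![0, 1, 1]) (sub c ![0, 1, 2]) (sub d ![0, 0, 1])
        (K.sub_thin_of_thin hk _ _) (C.sub_thin_of_thin hc _ _) (D.sub_thin_of_thin hd _ _)
        (Or.inr (degeneratesAlong01_sub d))) (app_triple_sub_sub f.hom k c d))
      (thin_of_eq hN (app_triple_sub_sub f.hom k c d))) (app_triple_sub_sub f.hom k c d).symm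
  -- In `(0112, 0122, 0112)` the face 012 is `h₁`, two other faces are Gray-thin because `c`
  -- degenerates along their edge 12, and the face 013 is `(k, c, d)`.
  have h₂ := hE.thin_013 (f.hom.app (op ⦋3⦌)
        (sub k ![0, 1, 1, 2], (sub c ![0, 1, 2, 2], sub d ![0, 1, 1, 2])))
      (thin_of_eq h₁ (app_triple_sub_sub f.hom k c d))
      (thin_of_eq (key (sub k ![0, 1, 2]) (sub c ![0, 2, 2]) (sub d ![0, 1, 2])
        (K.sub_thin_of_thin hk _ _) (C.sub_thin_of_thin hc _ _) (D.sub_thin_of_thin hd _ _)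
        (Or.inl (degeneratesAlong12_sub c))) (app_triple_sub_sub f.hom k c d))
      (thin_of_eq (key (sub k ![1, 1, 2]) (sub c ![1, 2, 2]) (sub d ![1, 1, 2])
        (K.sub_thin_of_thin hk _ _) (C.sub_thin_of_thin hc _ _) (D.sub_thin_of_thin hd _ _)
        (Or.inl (degeneratesAlong12_sub c))) (app_triple_sub_sub f.hom k c d))
  have e := app_triple_sub_sub f.hom k c d (u := ![0, 1, 1, 2]) (hu := by decide)
    (v := ![0, 1, 2, 2]) (hv := by decide) (w := ![0, 1, 1, 2]) (hw := by decide)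
    (i := ![0, 1, 3]) (hi := by decide) (u' := ![0, 1, 2]) (hu' := by decide)
    (v' := ![0, 1, 2]) (hv' := by decide) (w' := ![0, 1, 2]) (hw' := by decide)
  rw [sub_self k, sub_self c, sub_self d] at e
  exact thin_of_eq h₂ e.symm

end

end ScaledSSet

/-! ## A criterion for full faithfulness -/

/-- Naturality of the chosen preimages is forced by injectivity. -/
theorem SSet.exists_lift_of_injective {X A B : SSet.{u}} (i : A ⟶ B)
    (hi : ∀ n, Function.Injective (i.app n)) (f : X ⟶ B)
    (h : ∀ n (x : X.obj n), ∃ a, i.app n a = f.app n x) : ∃ g : X ⟶ A, g ≫ i = f := by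
  choose a ha using h
  refine ⟨{ app := fun n => ↾a n, naturality := fun n m k => ?_ }, ?_⟩
  · ext x
    apply hi
    have h1 : i.app m (a m (X.map k x)) = B.map k (f.app n x) :=
      (ha _ _).trans (NatTrans.naturality_apply f k x)
    have h2 : i.app m (A.map k (a n x)) = B.map k (f.app n x) :=
      (NatTrans.naturality_apply i k _).trans (congrArg (B.map k) (ha n x))
    exact h1.trans h2.symm
  · ext n x
    exact ha n x

theorem SSet.hom_ext_of_injective {X A B : SSet.{u}} (i : A ⟶ B)
    (hi : ∀ n, Function.Injective (i.app n)) {f g : X ⟶ A} (h : f ≫ i = g ≫ i) : f = g := by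
  ext n x
  exact hi n (ConcreteCategory.congr_hom (congr_app h n) x)

namespace MarkedSSet

theorem Homotopic.refl {X Y : MarkedSSet.{u}} (f : X ⟶ Y) : Homotopic f f :=
  ⟨Hom.mk (snd SSet.coherentIso X.toSSet ≫ f.hom) (fun _ he => f.map_marked _ he), rfl, rfl⟩

/-- A map of marked simplicial sets is an equivalence if it is bijective on simplices and
reflects marked edges. -/
theorem isEquivalence_of_bijective {X Y : MarkedSSet.{u}} (f : X ⟶ Y)
    (hf : ∀ n, Function.Bijective (f.hom.app n))
    (h : ∀ e, f.hom.app (op ⦋1⦌) e ∈ Y.marked → e ∈ X.marked) : IsEquivalence f := by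
  obtain ⟨g, hg⟩ := SSet.exists_lift_of_injective f.hom (fun n => (hf n).1) (𝟙 Y.toSSet)
    (fun n y => (hf n).2 y)
  have hg' : f.hom ≫ g = 𝟙 X.toSSet :=
    SSet.hom_ext_of_injective f.hom (fun n => (hf n).1) (by rw [Category.assoc, hg]; simp)
  let g' : Y ⟶ X := Hom.mk g (fun e he => h _
    ((congrArg (· ∈ Y.marked) (ConcreteCategory.congr_hom (congr_app hg (op ⦋1⦌)) e)).mpr he))
  have h1 : f ≫ g' = 𝟙 X := Hom.ext hg'
  have h2 : g' ≫ f = 𝟙 Y := Hom.ext hg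
  exact ⟨g', h1 ▸ Homotopic.refl _, h2 ▸ Homotopic.refl _⟩

end MarkedSSet

namespace ScaledSSet

open SSet

theorem const_app_vertex {X Y : SSet.{u}} (x : X _⦋0⦌) (y : Y _⦋0⦌) :
    (SSet.const x : Y ⟶ X).app (op ⦋0⦌) y = x :=
  (map_eq_sub x _).trans (SSet.sub_self x (fun _ => Subsingleton.elim (α := Fin 1) _ _))

/-- The inclusion of a full sub-bicategory, that is, of all the simplices and all the thin
triangles with vertices in a given set, is fully faithful. -/
theorem fullyFaithful_of_full {A B : ScaledSSet.{u}} (F : A ⟶ B)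
    (hinj : ∀ n, Function.Injective (F.hom.app n))
    (hfull : ∀ (n : ℕ) (b : B.toSSet _⦋n⦌),
      (∀ i : Fin (n + 1), ∃ a, F.hom.app (op ⦋0⦌) a = sub b (fun _ => i) (fun _ _ _ => le_rfl)) →
        ∃ a, F.hom.app (op ⦋n⦌) a = b)
    (hthin : ∀ t, F.hom.app (op ⦋2⦌) t ∈ B.thin → t ∈ A.thin) : FullyFaithful F := by
  intro x y
  refine MarkedSSet.isEquivalence_of_bijective _ (fun n => ⟨?_, ?_⟩) (fun e he => hthin _ he)
  · intro f g h
    exact Subtype.ext (hom_ext_of_injective F.hom hinj (congrArg Subtype.val h))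
  · rintro ⟨f, hf⟩
    -- Every vertex of `Δⁿ × Δ¹` lies over 0 or 1 in `Δ¹`, where `f` is constant at the image of `x`
    -- or of `y`; so all the simplices in the image of `f` have their vertices in the image of `F`.
    obtain ⟨g, hg⟩ := exists_lift_of_injective F.hom hinj f (by
      rintro m ⟨s, t⟩
      refine hfull m.unop.len _ (fun i => ?_)
      obtain ⟨k, hk⟩ := stdSimplex.obj₀Equiv.symm.surjective
        (sub (X := Δ[1]) (n := m.unop.len) t (fun _ : Fin 1 => i) (fun _ _ _ => le_rfl))
      have h : sub (X := B.toSSet) (n := m.unop.len) (f.app m (s, t)) (fun _ : Fin 1 => i)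
          (fun _ _ _ => le_rfl) = f.app (op ⦋0⦌)
            (sub (X := Δ[n.unop.len]) (n := m.unop.len) s (fun _ => i) (fun _ _ _ => le_rfl),
              stdSimplex.obj₀Equiv.symm k) := by
        rw [hk]
        exact (app_pair_sub f (n := m.unop.len) s t _ _).symm
      set v : Δ[n.unop.len] _⦋0⦌ :=
        sub (X := Δ[n.unop.len]) (n := m.unop.len) s (fun _ => i) (fun _ _ _ => le_rfl)
      fin_cases k
      · refine ⟨x, Eq.trans ?_ h.symm⟩
        have h' := ConcreteCategory.congr_hom (congr_app hf.source (op ⦋0⦌)) v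
        refine ((h'.trans (const_app_vertex _ _)).symm).trans ?_
        exact congrArg (fun z => f.app (op ⦋0⦌) (v, z))
          (const_app_vertex (stdSimplex.obj₀Equiv.symm 0) v)
      · refine ⟨y, Eq.trans ?_ h.symm⟩
        have h' := ConcreteCategory.congr_hom (congr_app hf.target (op ⦋0⦌)) v
        refine ((h'.trans (const_app_vertex _ _)).symm).trans ?_
        exact congrArg (fun z => f.app (op ⦋0⦌) (v, z))
          (const_app_vertex (stdSimplex.obj₀Equiv.symm 1) v))
    refine ⟨⟨g, ?_, ?_, fun i j hij => hthin _ ?_⟩, Subtype.ext hg⟩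
    · apply hom_ext_of_injective F.hom hinj
      rw [Category.assoc, hg, hf.source, SSet.const_comp]
    · apply hom_ext_of_injective F.hom hinj
      rw [Category.assoc, hg, hf.target, SSet.const_comp]
    · exact thin_of_eq (hf.thin i j hij)
        (ConcreteCategory.congr_hom (congr_app hg (op ⦋2⦌)) _).symm

/-! ## The restriction functor -/

section

variable {C D E : ScaledSSet.{u}}

/-- The extension of maps from the Gray product to the product with the scaling `T_≃`. -/
def grayInvExtension (hC : C.IsInfBicategory) (hD : D.IsInfBicategory) (hE : E.IsInfBicategory) :
    functor (gray C D) E ⟶ functor (grayInv C D) E :=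
  Hom.mk
    { app := fun n => ↾fun φ => Hom.mk (X := prod (flat (SSet.stdSimplex.obj n.unop)) (grayInv C D))
        (Y := E) (Hom.hom (X := prod (flat (SSet.stdSimplex.obj n.unop)) (gray C D)) (Y := E) φ)
        (isScaledMap_prod_grayInv hC hD hE φ)
      naturality := fun n m g => by
        ext φ
        rfl }
    -- The flat `K` above extends simplices; the sharp `K` here extends thin triangles.
    (fun φ hφ => isScaledMap_prod_grayInv (K := sharp Δ[2]) hC hD hE
      (Hom.mk (X := prod (sharp Δ[2]) (gray C D)) (Y := E)
        (Hom.hom (X := prod (flat Δ[2]) (gray C D)) (Y := E) φ) hφ))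

theorem isIso_grayInvRestriction (hC : C.IsInfBicategory) (hD : D.IsInfBicategory)
    (hE : E.IsInfBicategory) : IsIso (grayInvRestriction C D E) :=
  ⟨grayInvExtension hC hD hE, rfl, rfl⟩

theorem grayOplaxRestriction_eq (hC : C.IsInfBicategory) (hD : D.IsInfBicategory)
    (hE : E.IsInfBicategory) [IsIso (grayInvRestriction C D E)] :
    grayOplaxRestriction C D E =
      grayInvExtension hC hD hE ≫ functorPrecomp (oplaxToGrayInv C D) E := by
  have h : inv (grayInvRestriction C D E) = grayInvExtension hC hD hE :=
    IsIso.inv_eq_of_hom_inv_id rfl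
  rw [grayOplaxRestriction, h]

/-- The restriction is defined through an abstract `inv`. Replacing it by `grayInvExtension` shows
that underlying maps do not change, and it is in this form that the restriction is used below. -/
theorem grayOplaxRestriction_app_hom (hC : C.IsInfBicategory) (hD : D.IsInfBicategory)
    (hE : E.IsInfBicategory) [IsIso (grayInvRestriction C D E)] {n : ℕ}
    (φ : (functor (gray C D) E).toSSet _⦋n⦌) :
    Hom.hom (X := prod (flat Δ[n]) (oplax (prod C D))) (Y := E)
        ((grayOplaxRestriction C D E).hom.app (op ⦋n⦌) φ) =
      Hom.hom (X := prod (flat Δ[n]) (gray C D)) (Y := E) φ := by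
  rw [grayOplaxRestriction_eq hC hD hE]
  rfl

end

/-! ### Checking thinness one factor at a time on a product `W × Y`. -/

section

variable {W : SSet.{u}} {Y E : ScaledSSet.{u}}

/-- With `W = Δⁿ`, this says that a map respects the scaling of `Y` once it does so over each
vertex. For `τ` of the form 001 or 011, the tetrahedron `(0001, 0122)` or `(0111, 0012)` has one
face over a vertex, two faces degenerate in both factors, and `(τ, σ)` as its fourth. -/
theorem thin_of_degenerate_left (hE : E.IsInfBicategory) (f : W ⊗ Y.toSSet ⟶ E.toSSet)
    (h₀ : ∀ τ ∈ W.degenerate 2, ∀ σ ∈ Y.toSSet.degenerate 2, f.app (op ⦋2⦌) (τ, σ) ∈ E.thin)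
    (h₁ : ∀ (w : W _⦋0⦌), ∀ σ ∈ Y.thin, f.app (op ⦋2⦌) (sub w ![0, 0, 0], σ) ∈ E.thin)
    {τ : W _⦋2⦌} (hτ : τ ∈ W.degenerate 2) {σ : Y.toSSet _⦋2⦌} (hσ : σ ∈ Y.thin) :
    f.app (op ⦋2⦌) (τ, σ) ∈ E.thin := by
  rcases degenerate_triangle hτ with ⟨e, rfl⟩ | ⟨e, rfl⟩
  · rw [σ_eq_sub e 0 (v := ![0, 0, 1]) (hv := by decide)]
    have h := hE.thin_013 (f.app (op ⦋3⦌) (sub e ![0, 0, 0, 1], sub σ ![0, 1, 2, 2]))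
      (thin_of_eq (h₁ (sub e ![0]) (sub σ ![0, 1, 2]) (Y.sub_thin_of_thin hσ _ _))
        ((congrArg (fun x => f.app (op ⦋2⦌) (x, sub σ ![0, 1, 2]))
          (sub_sub_eq e (u := ![0, 0, 0]) (hu := by decide))).trans (app_pair_sub_sub f e σ)))
      (thin_of_eq (h₀ (sub e ![0, 0, 1]) (sub_mem_degenerate e 0 rfl) (sub σ ![0, 2, 2])
        (sub_mem_degenerate σ 1 rfl)) (app_pair_sub_sub f e σ))
      (thin_of_eq (h₀ (sub e ![0, 0, 1]) (sub_mem_degenerate e 0 rfl) (sub σ ![1, 2, 2])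
        (sub_mem_degenerate σ 1 rfl)) (app_pair_sub_sub f e σ))
    have e' := app_pair_sub_sub f e σ (v := ![0, 0, 0, 1]) (hv := by decide)
      (w := ![0, 1, 2, 2]) (hw := by decide) (i := ![0, 1, 3]) (hi := by decide)
      (v' := ![0, 0, 1]) (hv' := by decide) (w' := ![0, 1, 2]) (hw' := by decide)
    rw [SSet.sub_self σ] at e'
    exact thin_of_eq h e'.symm
  · rw [σ_eq_sub e 1 (v := ![0, 1, 1]) (hv := by decide)]
    have h := hE.thin_023 (f.app (op ⦋3⦌) (sub e ![0, 1, 1, 1], sub σ ![0, 0, 1, 2]))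
      (thin_of_eq (h₀ (sub e ![0, 1, 1]) (sub_mem_degenerate e 1 rfl) (sub σ ![0, 0, 1])
        (sub_mem_degenerate σ 0 rfl)) (app_pair_sub_sub f e σ))
      (thin_of_eq (h₀ (sub e ![0, 1, 1]) (sub_mem_degenerate e 1 rfl) (sub σ ![0, 0, 2])
        (sub_mem_degenerate σ 0 rfl)) (app_pair_sub_sub f e σ))
      (thin_of_eq (h₁ (sub e ![1]) (sub σ ![0, 1, 2]) (Y.sub_thin_of_thin hσ _ _))
        ((congrArg (fun x => f.app (op ⦋2⦌) (x, sub σ ![0, 1, 2]))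
          (sub_sub_eq e (u := ![1, 1, 1]) (hu := by decide))).trans (app_pair_sub_sub f e σ)))
    have e' := app_pair_sub_sub f e σ (v := ![0, 1, 1, 1]) (hv := by decide)
      (w := ![0, 0, 1, 2]) (hw := by decide) (i := ![0, 2, 3]) (hi := by decide)
      (v' := ![0, 1, 1]) (hv' := by decide) (w' := ![0, 1, 2]) (hw' := by decide)
    rw [SSet.sub_self σ] at e'
    exact thin_of_eq h e'.symm

/-- In the tetrahedron `(0012, 0112)` each of the faces 012, 013 and 123 is degenerate in at least
one factor, and the face 023 is `(τ, σ)`. This is how thin triangles of the functor object are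
reflected. -/
theorem thin_of_thin_right (hE : E.IsInfBicategory) (f : W ⊗ Y.toSSet ⟶ E.toSSet)
    (h₀ : ∀ τ, ∀ σ ∈ Y.toSSet.degenerate 2, f.app (op ⦋2⦌) (τ, σ) ∈ E.thin)
    (h₁ : ∀ τ ∈ W.degenerate 2, ∀ σ ∈ Y.thin, f.app (op ⦋2⦌) (τ, σ) ∈ E.thin)
    (τ : W _⦋2⦌) {σ : Y.toSSet _⦋2⦌} (hσ : σ ∈ Y.thin) : f.app (op ⦋2⦌) (τ, σ) ∈ E.thin := by
  have h := hE.thin_023 (f.app (op ⦋3⦌) (sub τ ![0, 0, 1, 2], sub σ ![0, 1, 1, 2]))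
    (thin_of_eq (h₀ (sub τ ![0, 0, 1]) (sub σ ![0, 1, 1]) (sub_mem_degenerate σ 1 rfl))
      (app_pair_sub_sub f τ σ))
    (thin_of_eq (h₁ (sub τ ![0, 0, 2]) (sub_mem_degenerate τ 0 rfl) (sub σ ![0, 1, 2])
      (Y.sub_thin_of_thin hσ _ _)) (app_pair_sub_sub f τ σ))
    (thin_of_eq (h₀ (sub τ ![0, 1, 2]) (sub σ ![1, 1, 2]) (sub_mem_degenerate σ 0 rfl))
      (app_pair_sub_sub f τ σ))
  have e' := app_pair_sub_sub f τ σ (v := ![0, 0, 1, 2]) (hv := by decide)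
    (w := ![0, 1, 1, 2]) (hw := by decide) (i := ![0, 2, 3]) (hi := by decide)
    (v' := ![0, 1, 2]) (hv' := by decide) (w' := ![0, 1, 2]) (hw' := by decide)
  rw [SSet.sub_self σ, SSet.sub_self τ] at e'
  exact thin_of_eq h e'.symm

end

theorem fullyFaithful_grayOplaxRestriction {C D E : ScaledSSet.{u}} (hC : C.IsInfBicategory)
    (hD : D.IsInfBicategory) (hE : E.IsInfBicategory) [IsIso (grayInvRestriction C D E)] :
    FullyFaithful (grayOplaxRestriction C D E) := by
  have hF {n : ℕ} (φ : (functor (gray C D) E).toSSet _⦋n⦌) :=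
    grayOplaxRestriction_app_hom hC hD hE φ
  refine fullyFaithful_of_full _ ?_ ?_ ?_
  · rintro ⟨n⟩ a b h
    refine hom_ext (X := prod (flat Δ[n.len]) (gray C D)) (Y := E) ?_
    rw [← hF (n := n.len) a, ← hF (n := n.len) b]
    exact congrArg (Hom.hom (X := prod (flat Δ[n.len]) (oplax (prod C D))) (Y := E)) h
  · intro n b hb
    let f : Δ[n] ⊗ (C.toSSet ⊗ D.toSSet) ⟶ E.toSSet :=
      Hom.hom (X := prod (flat Δ[n]) (oplax (prod C D))) (Y := E) b
    have hf : IsScaledMap (prod (flat Δ[n]) (oplax (prod C D))) E f := Hom.isScaledMap b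
    have hg : IsScaledMap (prod (flat Δ[n]) (gray C D)) E f := by
      rintro ⟨τ, σ⟩ ⟨hτ, hσ⟩
      refine thin_of_degenerate_left (Y := gray C D) hE f
        (fun τ hτ σ hσ => hf (τ, σ) ⟨hτ, (oplax (prod C D)).degenerate_subset hσ⟩) ?_ hτ hσ
      intro w σ hσ
      -- The vertex `i` of `b` comes from a map `a` on the Gray product, so `f` is Gray-scaled over
      -- it.
      obtain ⟨i, rfl⟩ := stdSimplex.obj₀Equiv.symm.surjective w
      obtain ⟨a, ha⟩ := hb i
      have h := Hom.isScaledMap (X := prod (flat Δ[0]) (gray C D)) (Y := E) a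
        (sub (stdSimplex.obj₀Equiv.symm 0) ![0, 0, 0], σ) ⟨sub_mem_degenerate _ 0 rfl, hσ⟩
      rw [← hF a, ha] at h
      refine thin_of_eq h (congrArg (fun x => f.app (op ⦋2⦌) (x, σ)) ?_)
      apply SSet.stdSimplex.ext (d := 2)
      intro j
      fin_cases j <;> rfl
    exact ⟨Hom.mk (X := prod (flat Δ[n]) (gray C D)) (Y := E) f hg,
      hom_ext (X := prod (flat Δ[n]) (oplax (prod C D))) (Y := E) (hF _)⟩
  · intro t ht
    have ht' : IsScaledMap (prod (sharp Δ[2]) (oplax (prod C D))) E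
        (Hom.hom (X := prod (flat Δ[2]) (gray C D)) (Y := E) t) := by
      rw [← hF t]
      exact ht
    rintro ⟨τ, σ⟩ ⟨-, hσ⟩
    exact thin_of_thin_right (Y := gray C D) hE
      (Hom.hom (X := prod (flat Δ[2]) (gray C D)) (Y := E) t)
      (fun τ σ hσ => ht' (τ, σ) ⟨trivial, (oplax (prod C D)).degenerate_subset hσ⟩)
      (fun τ hτ σ hσ => Hom.isScaledMap (X := prod (flat Δ[2]) (gray C D)) (Y := E) t
        (τ, σ) ⟨hτ, hσ⟩) τ hσ

/-! ## The essential image -/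

section

variable {C D E : ScaledSSet.{u}}

theorem const_app_sub {X Y : SSet.{u}} {n m : ℕ} (x : X _⦋n⦌) {i : Fin (n + 1)}
    {v : Fin (m + 1) → Fin (n + 1)} {hv} (h : ∀ j, i = v j) (y : Y _⦋m⦌) :
    (SSet.const (sub x (fun _ => i) (fun _ _ _ => le_rfl)) : Y ⟶ X).app (op ⦋m⦌) y =
      sub x v hv :=
  (map_eq_sub _ _).trans (sub_sub_eq x h)

theorem thin_of_restrictLeft {φ : oplax (prod C D) ⟶ E}
    (h : ∀ x : C.toSSet _⦋0⦌, IsScaledMap D E (restrictLeft φ x)) {n : ℕ} (f : C.toSSet _⦋n⦌)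
    {v : Fin 3 → Fin (n + 1)} {hv} {i : Fin (n + 1)} (hi : ∀ j, i = v j) {β : D.toSSet _⦋2⦌}
    (hβ : β ∈ D.thin) : φ.hom.app (op ⦋2⦌) (sub f v hv, β) ∈ E.thin :=
  thin_of_eq (h (sub f (fun _ => i) (fun _ _ _ => le_rfl)) β hβ)
    (congrArg (fun x => φ.hom.app (op ⦋2⦌) (x, β)) (const_app_sub f hi β))

theorem thin_of_restrictRight {φ : oplax (prod C D) ⟶ E}
    (h : ∀ y : D.toSSet _⦋0⦌, IsScaledMap C E (restrictRight φ y)) {n : ℕ} (g : D.toSSet _⦋n⦌)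
    {v : Fin 3 → Fin (n + 1)} {hv} {i : Fin (n + 1)} (hi : ∀ j, i = v j) {α : C.toSSet _⦋2⦌}
    (hα : α ∈ C.thin) : φ.hom.app (op ⦋2⦌) (α, sub g v hv) ∈ E.thin :=
  thin_of_eq (h (sub g (fun _ => i) (fun _ _ _ => le_rfl)) α hα)
    (congrArg (fun y => φ.hom.app (op ⦋2⦌) (α, y)) (const_app_sub g hi α))

theorem productTriangle_eq (f : C.toSSet _⦋1⦌) (g : D.toSSet _⦋1⦌) :
    productTriangle C D f g = (sub f ![0, 1, 1], sub g ![0, 0, 1]) :=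
  Prod.ext (σ_eq_sub f 1) (σ_eq_sub g 0)

theorem thin_of_productTriangle {φ : oplax (prod C D) ⟶ E}
    (h : ∀ (f : C.toSSet _⦋1⦌) (g : D.toSSet _⦋1⦌),
      φ.hom.app (op ⦋2⦌) (productTriangle C D f g) ∈ E.thin) {n m : ℕ} (f : C.toSSet _⦋n⦌)
    (g : D.toSSet _⦋m⦌) {v : Fin 3 → Fin (n + 1)} {hv} {w : Fin 3 → Fin (m + 1)} {hw}
    (hv' : v 1 = v 2 := by decide) (hw' : w 0 = w 1 := by decide) :
    φ.hom.app (op ⦋2⦌) (sub f v hv, sub g w hw) ∈ E.thin := by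
  have h' := h (sub (sub f v hv) ![0, 1]) (sub (sub g w hw) ![1, 2])
  rw [productTriangle_eq, sub_sub, sub_sub, sub_sub, sub_sub] at h'
  refine thin_of_eq h' (congrArg (φ.hom.app (op ⦋2⦌)) (Prod.ext (sub_congr f ?_) (sub_congr g ?_)))
  · exact funext (Fin.forall_fin_succ.2 ⟨rfl, Fin.forall_fin_two.2 ⟨rfl, hv'⟩⟩)
  · exact funext (Fin.forall_fin_succ.2 ⟨hw'.symm, Fin.forall_fin_two.2 ⟨rfl, rfl⟩⟩)

/-- If the triangle is 001 of an edge, then its face 12 is that edge; this being degenerate, the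
triangle is constant, hence also of the form 011. -/
theorem DegeneratesAlong12.exists_eq {X : SSet.{u}} {σ : X _⦋2⦌} (h : DegeneratesAlong12 σ) :
    ∃ e : X _⦋1⦌, σ = sub e ![0, 1, 1] := by
  obtain ⟨h, h'⟩ := h
  rcases degenerate_triangle h with ⟨e, rfl⟩ | ⟨e, rfl⟩
  · rw [σ_eq_sub e 0 (v := ![0, 0, 1]) (hv := by decide), δ_eq_sub _ 0 (v := ![1, 2])
      (hv := by decide), sub_sub_eq e (u := ![0, 1]) (hu := by decide), SSet.sub_self e] at h'
    obtain ⟨m, hm, g, x, rfl⟩ := h'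
    obtain rfl : m = 0 := by omega
    refine ⟨X.map g.op x, ?_⟩
    rw [σ_eq_sub _ 0 (v := ![0, 0, 1]) (hv := by decide), map_eq_sub x g, sub_sub, sub_sub]
    exact sub_congr x (funext fun _ => Subsingleton.elim (α := Fin 1) _ _)
  · exact ⟨e, σ_eq_sub e 1⟩

theorem DegeneratesAlong01.exists_eq {X : SSet.{u}} {σ : X _⦋2⦌} (h : DegeneratesAlong01 σ) :
    ∃ e : X _⦋1⦌, σ = sub e ![0, 0, 1] := by
  obtain ⟨h, h'⟩ := h
  rcases degenerate_triangle h with ⟨e, rfl⟩ | ⟨e, rfl⟩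
  · exact ⟨e, σ_eq_sub e 0⟩
  · rw [σ_eq_sub e 1 (v := ![0, 1, 1]) (hv := by decide), δ_eq_sub _ 2 (v := ![0, 1])
      (hv := by decide), sub_sub_eq e (u := ![0, 1]) (hu := by decide), SSet.sub_self e] at h'
    obtain ⟨m, hm, g, x, rfl⟩ := h'
    obtain rfl : m = 0 := by omega
    refine ⟨X.map g.op x, ?_⟩
    rw [σ_eq_sub _ 1 (v := ![0, 1, 1]) (hv := by decide), map_eq_sub x g, sub_sub, sub_sub]
    exact sub_congr x (funext fun _ => Subsingleton.elim (α := Fin 1) _ _)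

/-- A Gray-thin pair has the form `(011, β)` or `(α, 001)`. The tetrahedra `(0111, 0012)` and
`(0122, 0001)` have it as a face; of their other faces, two are product triangles and one lies over
a vertex of `C`, respectively of `D`. -/
theorem isScaledMap_gray (hE : E.IsInfBicategory) (φ : oplax (prod C D) ⟶ E)
    (hl : ∀ x : C.toSSet _⦋0⦌, IsScaledMap D E (restrictLeft φ x))
    (hr : ∀ y : D.toSSet _⦋0⦌, IsScaledMap C E (restrictRight φ y))
    (h : ∀ (f : C.toSSet _⦋1⦌) (g : D.toSSet _⦋1⦌),
      φ.hom.app (op ⦋2⦌) (productTriangle C D f g) ∈ E.thin) :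
    IsScaledMap (gray C D) E φ.hom := by
  rintro ⟨α, β⟩ ⟨⟨hα, hβ⟩, h' | h'⟩
  · obtain ⟨f, hf⟩ := h'.exists_eq
    obtain rfl : α = sub f ![0, 1, 1] := hf
    have key := hE.thin_023 (φ.hom.app (op ⦋3⦌) (sub f ![0, 1, 1, 1], sub β ![0, 0, 1, 2]))
      (thin_of_eq (thin_of_productTriangle h f β (v := ![0, 1, 1]) (w := ![0, 0, 1])
        (hv := by decide) (hw := by decide)) (app_pair_sub_sub φ.hom f β))
      (thin_of_eq (thin_of_productTriangle h f β (v := ![0, 1, 1]) (w := ![0, 0, 2])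
        (hv := by decide) (hw := by decide)) (app_pair_sub_sub φ.hom f β))
      (thin_of_eq (thin_of_restrictLeft hl f (v := ![1, 1, 1]) (hv := by decide) (i := 1)
        (by decide) (D.sub_thin_of_thin hβ ![0, 1, 2] (by decide))) (app_pair_sub_sub φ.hom f β))
    have e' := app_pair_sub_sub φ.hom f β (v := ![0, 1, 1, 1]) (hv := by decide)
      (w := ![0, 0, 1, 2]) (hw := by decide) (i := ![0, 2, 3]) (hi := by decide)
      (v' := ![0, 1, 1]) (hv' := by decide) (w' := ![0, 1, 2]) (hw' := by decide)
    rw [SSet.sub_self β] at e'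
    exact thin_of_eq key e'.symm
  · obtain ⟨g, hg⟩ := h'.exists_eq
    obtain rfl : β = sub g ![0, 0, 1] := hg
    have key := hE.thin_013 (φ.hom.app (op ⦋3⦌) (sub α ![0, 1, 2, 2], sub g ![0, 0, 0, 1]))
      (thin_of_eq (thin_of_restrictRight hr g (v := ![0, 0, 0]) (hv := by decide) (i := 0)
        (by decide) (C.sub_thin_of_thin hα ![0, 1, 2] (by decide))) (app_pair_sub_sub φ.hom α g))
      (thin_of_eq (thin_of_productTriangle h α g (v := ![0, 2, 2]) (w := ![0, 0, 1])
        (hv := by decide) (hw := by decide)) (app_pair_sub_sub φ.hom α g))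
      (thin_of_eq (thin_of_productTriangle h α g (v := ![1, 2, 2]) (w := ![0, 0, 1])
        (hv := by decide) (hw := by decide)) (app_pair_sub_sub φ.hom α g))
    have e' := app_pair_sub_sub φ.hom α g (v := ![0, 1, 2, 2]) (hv := by decide)
      (w := ![0, 0, 0, 1]) (hw := by decide) (i := ![0, 1, 3]) (hi := by decide)
      (v' := ![0, 1, 2]) (hv' := by decide) (w' := ![0, 0, 1]) (hw' := by decide)
    rw [SSet.sub_self α] at e'
    exact thin_of_eq key e'.symm

theorem restrictLeft_isScaledMap {φ : oplax (prod C D) ⟶ E}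
    (h : IsScaledMap (gray C D) E φ.hom) (x : C.toSSet _⦋0⦌) :
    IsScaledMap D E (restrictLeft φ x) := fun β hβ => by
  have e : (SSet.const x : D.toSSet ⟶ C.toSSet).app (op ⦋2⦌) β = sub x ![0, 0, 0] :=
    (map_eq_sub _ _).trans (sub_congr x (funext fun _ => Subsingleton.elim (α := Fin 1) _ _))
  refine thin_of_eq (h (sub x ![0, 0, 0], β) ⟨⟨C.sub_thin_of_degenerate x, hβ⟩,
    Or.inl (degeneratesAlong12_sub x)⟩) ?_
  exact congrArg (fun x => φ.hom.app (op ⦋2⦌) (x, β)) e.symm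

theorem restrictRight_isScaledMap {φ : oplax (prod C D) ⟶ E}
    (h : IsScaledMap (gray C D) E φ.hom) (y : D.toSSet _⦋0⦌) :
    IsScaledMap C E (restrictRight φ y) := fun α hα => by
  have e : (SSet.const y : C.toSSet ⟶ D.toSSet).app (op ⦋2⦌) α = sub y ![0, 0, 0] :=
    (map_eq_sub _ _).trans (sub_congr y (funext fun _ => Subsingleton.elim (α := Fin 1) _ _))
  refine thin_of_eq (h (α, sub y ![0, 0, 0]) ⟨⟨hα, D.sub_thin_of_degenerate y⟩,
    Or.inr (degeneratesAlong01_sub y)⟩) ?_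
  exact congrArg (fun y => φ.hom.app (op ⦋2⦌) (α, y)) e.symm

theorem productTriangle_thin {φ : oplax (prod C D) ⟶ E}
    (h : IsScaledMap (gray C D) E φ.hom) (f : C.toSSet _⦋1⦌) (g : D.toSSet _⦋1⦌) :
    φ.hom.app (op ⦋2⦌) (productTriangle C D f g) ∈ E.thin := by
  rw [productTriangle_eq]
  exact h _ ⟨⟨C.sub_thin_of_degenerate f, D.sub_thin_of_degenerate g⟩,
    Or.inl (degeneratesAlong12_sub f)⟩

end

/-! ## Invertible edges of functors -/

/-- The evaluation at a vertex of `X`. -/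
def evaluation {X : ScaledSSet.{u}} (E : ScaledSSet.{u}) (p : X.toSSet _⦋0⦌) :
    functor X E ⟶ E :=
  Hom.mk
    { app := fun n => ↾fun φ =>
        (Hom.hom (X := prod (flat (SSet.stdSimplex.obj n.unop)) X) (Y := E) φ).app n
          (stdSimplex.objEquiv.symm (𝟙 n.unop),
            X.toSSet.map (SimplexCategory.const n.unop ⦋0⦌ 0).op p)
      naturality := fun n m g => by
        ext φ
        let f : SSet.stdSimplex.obj n.unop ⊗ X.toSSet ⟶ E.toSSet :=
          Hom.hom (X := prod (flat (SSet.stdSimplex.obj n.unop)) X) (Y := E) φ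
        have h := NatTrans.naturality_apply f g ((stdSimplex.objEquiv.symm (𝟙 n.unop),
            X.toSSet.map (SimplexCategory.const n.unop ⦋0⦌ 0).op p) :
              (SSet.stdSimplex.obj n.unop ⊗ X.toSSet : SSet.{u}).obj n)
        refine Eq.trans ?_ h
        refine congrArg (f.app m) (Prod.ext ?_ ?_)
        · exact stdSimplex.objEquiv.injective
            ((Category.id_comp g.unop).trans (Category.comp_id g.unop).symm)
        · exact (congrArg (fun k => X.toSSet.map (Quiver.Hom.op k) p)
            (Subsingleton.elim _ (g.unop ≫ SimplexCategory.const n.unop ⦋0⦌ 0))).trans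
              (Functor.map_comp_apply X.toSSet _ g p) }
    (fun φ hφ => hφ (stdSimplex.objEquiv.symm (𝟙 _), _) ⟨trivial,
      X.degenerate_subset ⟨0, by norm_num, SimplexCategory.const ⦋2⦌ ⦋0⦌ 0, p, rfl⟩⟩)

/-- Thinness passes across the prism `k × σ`, one tetrahedron at a time. The last tetrahedron
requires cancelling its first edge, hence the invertibility at the initial vertex of `σ`. -/
theorem thin_of_isInvertible {K X E : ScaledSSet.{u}} (hE : E.IsInfBicategory)
    (f : prod K X ⟶ E) (k : K.toSSet _⦋1⦌) (σ : X.toSSet _⦋2⦌)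
    (hinv : E.IsInvertible (f.hom.app (op ⦋1⦌) (k, sub σ ![0, 0])))
    (h : f.hom.app (op ⦋2⦌) (sub k ![0, 0, 0], σ) ∈ E.thin) :
    f.hom.app (op ⦋2⦌) (sub k ![1, 1, 1], σ) ∈ E.thin := by
  -- Of the two witnesses of invertibility, `thin_123` needs the one exhibiting a section of the
  -- edge.
  obtain ⟨-, -, s, hs, -, -, hs12, hs02, -⟩ := hE.exists_inverse hinv
  have key {n m : ℕ} (x : K.toSSet _⦋n⦌) (y : X.toSSet _⦋m⦌) (v : Fin 3 → Fin (n + 1)) (hv)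
      (w : Fin 3 → Fin (m + 1)) (hw) (h : v 0 = v 1 ∨ v 1 = v 2) (h' : w 0 = w 1 ∨ w 1 = w 2) :
      f.hom.app (op ⦋2⦌) (sub x v hv, sub y w hw) ∈ E.thin :=
    f.isScaledMap _ ⟨K.sub_thin_of_degenerate x h, X.sub_thin_of_degenerate y h'⟩
  have hσ : f.hom.app (op ⦋2⦌) (sub k ![0, 0, 0], σ) =
      f.hom.app (op ⦋2⦌) (sub k ![0, 0, 0], sub σ ![0, 1, 2]) := by rw [SSet.sub_self σ]
  have h₁ : f.hom.app (op ⦋2⦌) (sub k ![0, 0, 1], sub σ ![0, 1, 2]) ∈ E.thin :=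
    thin_of_eq (hE.thin_013 (f.hom.app (op ⦋3⦌) (sub k ![0, 0, 0, 1], sub σ ![0, 1, 2, 2]))
      (thin_of_eq h (hσ.trans (app_pair_sub_sub f.hom k σ)))
      (thin_of_eq (key k σ ![0, 0, 1] (by decide) ![0, 2, 2] (by decide) (by decide) (by decide))
        (app_pair_sub_sub f.hom k σ))
      (thin_of_eq (key k σ ![0, 0, 1] (by decide) ![1, 2, 2] (by decide) (by decide) (by decide))
        (app_pair_sub_sub f.hom k σ))) (app_pair_sub_sub f.hom k σ).symm
  have h₂ : f.hom.app (op ⦋2⦌) (sub k ![0, 1, 1], sub σ ![0, 1, 2]) ∈ E.thin :=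
    thin_of_eq (hE.thin_023 (f.hom.app (op ⦋3⦌) (sub k ![0, 0, 1, 1], sub σ ![0, 1, 1, 2]))
      (thin_of_eq (key k σ ![0, 0, 1] (by decide) ![0, 1, 1] (by decide) (by decide) (by decide))
        (app_pair_sub_sub f.hom k σ))
      (thin_of_eq h₁ (app_pair_sub_sub f.hom k σ))
      (thin_of_eq (key k σ ![0, 1, 1] (by decide) ![1, 1, 2] (by decide) (by decide) (by decide))
        (app_pair_sub_sub f.hom k σ))) (app_pair_sub_sub f.hom k σ).symm
  have hk : f.hom.app (op ⦋1⦌) (k, sub σ ![0, 0]) =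
      f.hom.app (op ⦋1⦌) (sub k ![0, 1], sub σ ![0, 0]) := by rw [SSet.sub_self k]
  -- In the tetrahedron `(0111, 0012)` the first edge is the invertible one and the face opposite to
  -- its initial vertex is `(111, σ)`.
  have h₃ := hE.thin_123
    (f.hom.app (op ⦋3⦌) (sub k ![0, 1, 1, 1], sub σ ![0, 0, 1, 2])) s hs
    (hs12.trans (hk.trans (app_pair_sub_sub f.hom k σ)))
    (hs02.trans ((congrArg (fun x => sub x ![1, 1]) (hk.trans
      (app_pair_sub_sub f.hom k σ (i := ![0, 1]) (hi := by decide)))).trans (sub_sub_eq _)))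
    (thin_of_eq (key k σ ![0, 1, 1] (by decide) ![0, 0, 1] (by decide) (by decide) (by decide))
      (app_pair_sub_sub f.hom k σ))
    (thin_of_eq (key k σ ![0, 1, 1] (by decide) ![0, 0, 2] (by decide) (by decide) (by decide))
      (app_pair_sub_sub f.hom k σ))
    (thin_of_eq h₂ (app_pair_sub_sub f.hom k σ))
  have e' := app_pair_sub_sub f.hom k σ (v := ![0, 1, 1, 1]) (hv := by decide)
    (w := ![0, 0, 1, 2]) (hw := by decide) (i := ![1, 2, 3]) (hi := by decide)
    (v' := ![1, 1, 1]) (hv' := by decide) (w' := ![0, 1, 2]) (hw' := by decide)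
  rw [SSet.sub_self σ] at e'
  exact thin_of_eq h₃ e'.symm

/-- An oplax functor which is equivalent to one that is defined on the Gray product is itself
defined on the Gray product. -/
theorem isScaledMap_gray_of_inEssentialImage {C D E : ScaledSSet.{u}} (hC : C.IsInfBicategory)
    (hD : D.IsInfBicategory) (hE : E.IsInfBicategory) [IsIso (grayInvRestriction C D E)]
    (φ : oplax (prod C D) ⟶ E)
    (h : InEssentialImage (grayOplaxRestriction C D E) (functorVertex φ)) :
    IsScaledMap (gray C D) E φ.hom := by
  obtain ⟨c, e, he⟩ := h
  intro σ hσ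
  -- The edge `e` is a map `f` on `Δ¹ × (C × D)`. Over the ends of the nondegenerate edge `k` it
  -- restricts to the image of `c` and to `φ`, so Gray-thinness is transported from the former to
  -- the latter.
  let k : Δ[1] _⦋1⦌ := stdSimplex.objEquiv.symm (𝟙 _)
  let f : prod (flat Δ[1]) (oplax (prod C D)) ⟶ E := e.edge
  have h := thin_of_isInvertible hE f k σ ?_ ?_
  · have h' := congrArg (fun ψ => (Hom.hom (X := prod (flat Δ[0]) (oplax (prod C D)))
      (Y := E) ψ).app (op ⦋2⦌) (sub (stdSimplex.obj₀Equiv.symm 0) ![0, 0, 0], σ)) e.tgt_eq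
    refine thin_of_eq h (Eq.trans (congrArg (fun x => f.hom.app (op ⦋2⦌) (x, σ)) ?_) h')
    apply SSet.stdSimplex.ext (d := 2)
    intro j
    fin_cases j <;> rfl
  -- Evaluation at the initial vertex of `σ` is a map of scaled simplicial sets, so it preserves the
  -- invertibility of `e`.
  · have h' := IsInvertible.map (X := functorOplax (prod C D) E) (evaluation E (sub σ ![0])) he
    refine (congrArg E.IsInvertible (congrArg (fun x => f.hom.app (op ⦋1⦌) (k, x)) ?_)).mp h'
    exact (map_eq_sub _ _).trans (sub_sub_eq σ (by decide))
  · have h' := congrArg (fun ψ => (Hom.hom (X := prod (flat Δ[0]) (oplax (prod C D)))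
      (Y := E) ψ).app (op ⦋2⦌) (sub (stdSimplex.obj₀Equiv.symm 0) ![0, 0, 0], σ)) e.src_eq
    have h₀ := Hom.isScaledMap (X := prod (flat Δ[0]) (gray C D)) (Y := E) c
      (sub (stdSimplex.obj₀Equiv.symm 0) ![0, 0, 0], σ) ⟨sub_mem_degenerate _ 0 rfl, hσ⟩
    rw [← grayOplaxRestriction_app_hom hC hD hE c] at h₀
    refine thin_of_eq h₀ (h'.symm.trans (congrArg (fun x => f.hom.app (op ⦋2⦌) (x, σ)) ?_))
    apply SSet.stdSimplex.ext (d := 2)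
    intro j
    fin_cases j <;> rfl

/-- Here `φ` is even in the strict image, so the degenerate edge at it suffices. -/
theorem inEssentialImage_grayOplaxRestriction {C D E : ScaledSSet.{u}} (hC : C.IsInfBicategory)
    (hD : D.IsInfBicategory) (hE : E.IsInfBicategory) [IsIso (grayInvRestriction C D E)]
    (φ : oplax (prod C D) ⟶ E) (h : IsScaledMap (gray C D) E φ.hom) :
    InEssentialImage (grayOplaxRestriction C D E) (functorVertex φ) := by
  let c : (functor (gray C D) E).toSSet _⦋0⦌ := functorVertex (X := gray C D) (Hom.mk φ.hom h)
  have hc : (grayOplaxRestriction C D E).hom.app (op ⦋0⦌) c = functorVertex φ :=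
    hom_ext (X := prod (flat Δ[0]) (oplax (prod C D))) (Y := E)
      (grayOplaxRestriction_app_hom hC hD hE c)
  rw [← hc]
  exact ⟨c, Edge.id _, isInvertible_of_degenerate _ (σ_mem_degenerate _ _ _)⟩

end ScaledSSet

/-! ### The universal property of the Gray product. -/

theorem mainTheorem4 (C D E : ScaledSSet.{u}) (hC : C.IsInfBicategory)
    (hD : D.IsInfBicategory) (hE : E.IsInfBicategory) :
    ∃ _ : IsIso (ScaledSSet.grayInvRestriction C D E),
      ScaledSSet.FullyFaithful (ScaledSSet.grayOplaxRestriction C D E) ∧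
      ∀ φ : ScaledSSet.oplax (ScaledSSet.prod C D) ⟶ E,
        ScaledSSet.InEssentialImage (ScaledSSet.grayOplaxRestriction C D E)
            (ScaledSSet.functorVertex φ) ↔
          (∀ x : C.toSSet _⦋0⦌, ScaledSSet.IsScaledMap D E (ScaledSSet.restrictLeft φ x)) ∧
          (∀ y : D.toSSet _⦋0⦌, ScaledSSet.IsScaledMap C E (ScaledSSet.restrictRight φ y)) ∧
          (∀ (f : C.toSSet _⦋1⦌) (g : D.toSSet _⦋1⦌),
            φ.hom.app (op ⦋2⦌) (ScaledSSet.productTriangle C D f g) ∈ E.thin) := by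
  have := ScaledSSet.isIso_grayInvRestriction hC hD hE
  refine ⟨this, ScaledSSet.fullyFaithful_grayOplaxRestriction hC hD hE, fun φ => ⟨fun h => ?_, ?_⟩⟩
  · have h' := ScaledSSet.isScaledMap_gray_of_inEssentialImage hC hD hE φ h
    exact ⟨ScaledSSet.restrictLeft_isScaledMap h', ScaledSSet.restrictRight_isScaledMap h',
      ScaledSSet.productTriangle_thin h'⟩
  · rintro ⟨hl, hr, h⟩
    exact ScaledSSet.inEssentialImage_grayOplaxRestriction hC hD hE φ
      (ScaledSSet.isScaledMap_gray hE φ hl hr h)
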